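/- For a field $F$ and a linear representation $\rho : G \to \mathrm{Aut}_F(V)$ of a group $G$, call the $G$-module $V$ \emph{very simple} if every $F$-subalgebra $R \subset \mathrm{End}_F(V)$ containing $\mathrm{Id}$ with $\rho(\sigma) R \rho(\sigma)^{-1} \subset R$ for all $\sigma \in G$ is either $F \cdot \mathrm{Id}$ or $\mathrm{End}_F(V)$. For a finite set $B$ with $n$ elements, let $\mathrm{Perm}(B)$ act on the space $\mathbf{F}_2^B$ of maps $h : B \to \mathbf{F}_2$ by $(sh)(b) = h(s^{-1}(b))$, let $(\mathbf{F}_2^B)^0 = \{h : \sum_{b \in B} h(b) = 0\}$, and let $1_B$ be the constant function $1$. Put $Q_B = (\mathbf{F}_2^B)^0$ if $n$ is odd and $Q_B = (\mathbf{F}_2^B)^0/(\mathbf{F}_2 \cdot 1_B)$ if $n$ is even. **Theorem.** Let $n$ be a positive integer, $B$ an $n$-element set and $G \subset \mathrm{Perm}(B)$ a permutation group. Assume that one of the following holds: (i) $n = 11$ and $G$ is isomorphic either to $\mathbf{L}_2(11) = \mathrm{PSL}_2(\mathbf{F}_{11})$ or to the Mathieu group $\mathrm{M}_{11}$; (ii)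 $n = 12$ and either $G$ is isomorphic to the Mathieu group $\mathrm{M}_{12}$, or $G$ is isomorphic to $\mathrm{M}_{11}$ and $G$ acts transitively on $B$. Then the $G$-module $Q_B$ is very simple. -/

import Mathlib

open Equiv

/-- A linear representation `ρ : G → Aut_F(V)` is very simple if every (unital) `F`-subalgebra `R`
of `End_F(V)` that is stable under conjugation by all `ρ(σ)`, `σ ∈ G`, is either `F · Id` or
`End_F(V)`. -/
def IsVerySimple {F G V : Type*} [Field F] [Group G] [AddCommGroup V] [Module F V]
    (ρ : Representation F G V) : Prop :=
  ∀ R : Subalgebra F (Module.End F V),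
    (∀ σ : G, ∀ r ∈ R, ρ σ * r * ρ σ⁻¹ ∈ R) → R = ⊥ ∨ R = ⊤

section PermutationModules

variable (F : Type*) [Field F] (B : Type*)

/-- The permutation module `F^B` of all maps `h : B → F`; a permutation `s` of `B` sends `h` to
the map `b ↦ h (s⁻¹ b)`. -/
def permRep : Representation F (Perm B) (B → F) where
  toFun s := LinearMap.funLeft F F (s⁻¹ : Perm B)
  map_one' := by ext; simp
  map_mul' s t := by ext; simp [LinearMap.funLeft]

theorem permRep_apply (s : Perm B) (h : B → F) (b : B) : permRep F B s h b = h (s⁻¹ b) := rfl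

/-- The hyperplane `(F^B)^0` of the maps `h : B → F` with `∑ h(b) = 0`. -/
def sumZero [Fintype B] : Submodule F (B → F) where
  carrier := {h | ∑ b, h b = 0}
  zero_mem' := by simp
  add_mem' {h k} hh hk := by
    simp only [Set.mem_ofPred_eq] at hh hk ⊢
    simp [Finset.sum_add_distrib, hh, hk]
  smul_mem' c h hh := by
    simp only [Set.mem_ofPred_eq] at hh ⊢
    simp [← Finset.mul_sum, hh]

theorem mem_sumZero [Fintype B] (h : B → F) : h ∈ sumZero F B ↔ ∑ b, h b = 0 := Iff.rfl

/-- The action of `Perm B` on the stable hyperplane `(F^B)^0`. -/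
def sumZeroRep [Fintype B] : Representation F (Perm B) (sumZero F B) :=
  (permRep F B).subrepresentation (sumZero F B) fun s h hh => by
    rw [Submodule.mem_comap, mem_sumZero]
    rw [mem_sumZero] at hh
    rw [← hh]
    exact Equiv.sum_comp (s⁻¹ : Perm B) h

/-- The elements of `(F^B)^0` that lie on the line `F · 1_B` spanned by the constant function `1`.
If the characteristic of `F` divides the cardinality of `B`, this is the whole line `F · 1_B`. -/
def constLine [Fintype B] : Submodule F (sumZero F B) :=
  (Submodule.span F {(1 : B → F)}).comap (sumZero F B).subtype

/-- The action of `Perm B` on the quotient `(F^B)^0 / (F · 1_B)`. -/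
def heartRep [Fintype B] : Representation F (Perm B) (sumZero F B ⧸ constLine F B) :=
  (sumZeroRep F B).quotient (constLine F B) fun s h hh => by
    obtain ⟨c, hc⟩ := Submodule.mem_span_singleton.1 (Submodule.mem_comap.1 hh)
    refine Submodule.mem_span_singleton.2 ⟨c, ?_⟩
    ext b
    exact congrFun hc ((s⁻¹ : Perm B) b)

end PermutationModules

/-- For a permutation group `G ⊆ Perm B`: the `G`-module `Q_B` is very simple. Here
`Q_B = (𝔽₂^B)^0 / (𝔽₂ · 1_B)` if the number of elements of `B` is even, and
`Q_B = (𝔽₂^B)^0` if it is odd. -/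
def QIsVerySimple {B : Type*} [Fintype B] (G : Subgroup (Perm B)) : Prop :=
  if Even (Fintype.card B) then IsVerySimple ((heartRep (ZMod 2) B).comp G.subtype)
  else IsVerySimple ((sumZeroRep (ZMod 2) B).comp G.subtype)

/-- The Mathieu group `M₁₁`, as the group of permutations of 11 letters generated by
`(1,2,3,4,5,6,7,8,9,10,11)` and `(3,7,11,8)(4,10,5,6)`
(the letters `1, …, 11` are written `0, …, 10` below). -/
def MathieuM11 : Subgroup (Perm (Fin 11)) :=
  Subgroup.closure
    {List.formPerm [0, 1, 2, 3, 4, 5, 6, 7, 8, 9, 10],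
     List.formPerm [2, 6, 10, 7] * List.formPerm [3, 9, 4, 5]}

/-- The Mathieu group `M₁₂`, as the group of permutations of 12 letters generated by
`(1,2,3,4,5,6,7,8,9,10,11)`, `(3,7,11,8)(4,10,5,6)` and `(1,12)(2,11)(3,6)(4,8)(5,9)(7,10)`
(the letters `1, …, 12` are written `0, …, 11` below). -/
def MathieuM12 : Subgroup (Perm (Fin 12)) :=
  Subgroup.closure
    {List.formPerm [0, 1, 2, 3, 4, 5, 6, 7, 8, 9, 10],
     List.formPerm [2, 6, 10, 7] * List.formPerm [3, 9, 4, 5],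
     List.formPerm [0, 11] * List.formPerm [1, 10] * List.formPerm [2, 5] *
       List.formPerm [3, 7] * List.formPerm [4, 8] * List.formPerm [6, 9]}

section Semilinear

variable {R V : Type*} [Ring R] [AddCommGroup V] [Module R V] {σ : R →+* R} {σ' : R →+* R}
  [RingHomInvPair σ σ'] [RingHomInvPair σ' σ]

theorem Submodule.nonempty_map_linearEquiv_map (L : V ≃ₛₗ[σ] V) {m W : Submodule R V}
    (h : Nonempty (m ≃ₗ[R] W)) :
    Nonempty (m.map (L : V →ₛₗ[σ] V) ≃ₗ[R] W.map (L : V →ₛₗ[σ] V)) := by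
  obtain ⟨φ⟩ := h
  exact ⟨((L.submoduleMap m).symm.trans φ).trans (L.submoduleMap W)⟩

theorem map_isotypicComponent_le (L : V ≃ₛₗ[σ] V) (W : Submodule R V) :
    (isotypicComponent R V W).map (L : V →ₛₗ[σ] V) ≤
      isotypicComponent R V (W.map (L : V →ₛₗ[σ] V)) := by
  rw [isotypicComponent, Submodule.map_le_iff_le_comap]
  refine sSup_le fun m hm => ?_
  rw [← Submodule.map_le_iff_le_comap]
  exact le_sSup (Submodule.nonempty_map_linearEquiv_map L hm)

theorem map_isotypicComponent (L : V ≃ₛₗ[σ] V) (W : Submodule R V) :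
    (isotypicComponent R V W).map (L : V →ₛₗ[σ] V) =
      isotypicComponent R V (W.map (L : V →ₛₗ[σ] V)) := by
  refine le_antisymm (map_isotypicComponent_le L W) ?_
  have key := map_isotypicComponent_le L.symm (W.map (L : V →ₛₗ[σ] V))
  have e : (W.map (L : V →ₛₗ[σ] V)).map (L.symm : V →ₛₗ[σ'] V) = W := by
    ext x; simp
  rw [e] at key
  intro x hx
  refine ⟨L.symm x, key ⟨x, hx, rfl⟩, by simp⟩

theorem isSimpleModule_map (L : V ≃ₛₗ[σ] V) (W : Submodule R V) [IsSimpleModule R W] :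
    IsSimpleModule R (W.map (L : V →ₛₗ[σ] V)) :=
  (LinearMap.isSimpleModule_iff_of_bijective ((L.submoduleMap W : W ≃ₛₗ[σ] _) : W →ₛₗ[σ] _)
    (L.submoduleMap W).bijective).1 inferInstance

theorem map_mem_isotypicComponents (L : V ≃ₛₗ[σ] V) {T : Submodule R V}
    (hT : T ∈ isotypicComponents R V) :
    T.map (L : V →ₛₗ[σ] V) ∈ isotypicComponents R V := by
  obtain ⟨W, hW, rfl⟩ := hT
  exact ⟨_, isSimpleModule_map L W, map_isotypicComponent L W⟩

end Semilinear

theorem exists_fixed_point_of_iterate {α : Type*} [Finite α] {p : ℕ} (hp : p.Prime)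
    (hα : ¬ p ∣ Nat.card α) (f : α → α) (hf : ∀ a, f^[p] a = a) : ∃ a, f a = a := by
  have := Fintype.ofFinite α
  have := Fact.mk hp
  have hbij : Function.Bijective f := by
    have h : Function.Bijective (f^[p]) := by
      rw [show f^[p] = id from funext hf]; exact Function.bijective_id
    refine ⟨Function.Injective.of_comp (f := f^[p - 1]) ?_, ?_⟩
    · rw [← Function.iterate_succ, Nat.succ_eq_add_one, Nat.sub_add_cancel hp.one_le]
      exact h.1
    · refine Function.Surjective.of_comp (g := f^[p - 1]) ?_
      rw [← Function.iterate_succ', Nat.succ_eq_add_one, Nat.sub_add_cancel hp.one_le]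
      exact h.2
  rw [Nat.card_eq_fintype_card] at hα
  have h1 : (Equiv.ofBijective f hbij) ^ p ^ 1 = 1 := by
    ext a
    rw [pow_one, Perm.coe_pow]
    exact hf a
  exact Equiv.Perm.exists_fixed_point_of_prime hα h1

theorem not_eleven_dvd_two_pow_sub_one {f : ℕ} (h0 : 0 < f) (h : f < 10) : ¬ 11 ∣ 2 ^ f - 1 := by
  interval_cases f <;> decide

theorem iSupIndep.card_le_finrank {F V ι : Type*} [Field F] [AddCommGroup V] [Module F V]
    [FiniteDimensional F V] [Finite ι] {p : ι → Submodule F V} (hp : iSupIndep p)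
    (h0 : ∀ i, p i ≠ ⊥) : Nat.card ι ≤ Module.finrank F V := by
  classical
  have := Fintype.ofFinite ι
  have := Fintype.ofFinite {i // p i ≠ ⊥}
  have h := hp.subtype_ne_bot_le_finrank
  rw [← Nat.card_eq_fintype_card] at h
  rwa [Nat.card_congr (Equiv.subtypeUnivEquiv h0)] at h

section Isotypic

variable {F V : Type*} [Field F] [AddCommGroup V] [Module F V] [FiniteDimensional F V]
  {R : Subalgebra F (Module.End F V)} {σ σ' : R →+* R} [RingHomInvPair σ σ'] [RingHomInvPair σ' σ]

theorem Subalgebra.card_isotypicComponents_le :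
    Nat.card (isotypicComponents R V) ≤ Module.finrank F V := by
  have : IsNoetherian R V := isNoetherian_of_tower F inferInstance
  have hi := ((sSupIndep_iff _).1 (sSupIndep_isotypicComponents R V))
  have hi' : iSupIndep fun T : isotypicComponents R V => (T : Submodule R V).restrictScalars F := by
    intro T
    rw [disjoint_iff]
    have := disjoint_iff.1 (hi T)
    rw [← Submodule.restrictScalars_bot F R V, ← this, Submodule.restrictScalars_inf]
    congr 1
    exact (map_iSup₂ (Submodule.restrictScalarsLatticeHom F R V) _).symm
  refine hi'.card_le_finrank fun T => ?_
  rw [Ne, Submodule.restrictScalars_eq_bot_iff]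
  exact (bot_lt_isotypicComponents T.2).ne'

theorem isIsotypic_of_semilinearEquiv [Nontrivial V] (L : V ≃ₛₗ[σ] V) {p : ℕ} (hp : p.Prime)
    (hdim : Module.finrank F V < p) (hL : ∀ v, L^[p] v = v)
    (hirr : ∀ U : Submodule F V, (∀ u ∈ U, L u ∈ U) → U = ⊥ ∨ U = ⊤) :
    IsSemisimpleModule R V ∧ IsIsotypic R V := by
  have : IsNoetherian R V := isNoetherian_of_tower F inferInstance
  have : IsArtinian R V := isArtinian_of_tower F inferInstance
  obtain ⟨S, hS⟩ := IsAtomic.exists_atom (Submodule R V)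
  rw [← isSimpleModule_iff_isAtom] at hS
  have hne : Nonempty (isotypicComponents R V) := ⟨⟨_, S, hS, rfl⟩⟩
  have hdvd : ¬ p ∣ Nat.card (isotypicComponents R V) := fun h =>
    absurd (Nat.le_of_dvd Nat.card_pos h)
      (not_le.2 (Subalgebra.card_isotypicComponents_le.trans_lt hdim))
  obtain ⟨⟨T, hT⟩, hfix⟩ := exists_fixed_point_of_iterate hp hdvd
    (fun T => ⟨_, map_mem_isotypicComponents L T.2⟩) (by
      have key : ∀ n (T : isotypicComponents R V) (v : V),
          v ∈ (((fun T : isotypicComponents R V => (⟨_, map_mem_isotypicComponents L T.2⟩ :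
            isotypicComponents R V))^[n] T : isotypicComponents R V) : Submodule R V) ↔
            ∃ w ∈ T.1, L^[n] w = v := by
        intro n
        induction n with
        | zero => intro T v; simp
        | succ n ih =>
          intro T v
          rw [Function.iterate_succ_apply, ih]
          simp only [Submodule.mem_map]
          constructor
          · rintro ⟨w, ⟨u, hu, rfl⟩, rfl⟩
            exact ⟨u, hu, rfl⟩
          · rintro ⟨u, hu, rfl⟩
            exact ⟨L u, ⟨u, hu, rfl⟩, rfl⟩
      intro T
      ext v
      rw [key]
      simp [hL])
  have hfix' : T.map (L : V →ₛₗ[σ] V) = T := congrArg Subtype.val hfix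
  have htop : T = ⊤ := by
    rw [← Submodule.restrictScalars_eq_top_iff F]
    refine (hirr (T.restrictScalars F) fun u hu => ?_).resolve_left ?_
    · rw [Submodule.restrictScalars_mem] at hu ⊢
      rw [← hfix']
      exact ⟨u, hu, rfl⟩
    · rw [Submodule.restrictScalars_eq_bot_iff]
      exact (bot_lt_isotypicComponents hT).ne'
  obtain ⟨W, hW, rfl⟩ := hT
  have e : isotypicComponent R V W ≃ₗ[R] V := (LinearEquiv.ofEq _ _ htop).trans Submodule.topEquiv
  have : IsSemisimpleModule R V := IsSemisimpleModule.congr (M := isotypicComponent R V W) e.symm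
  exact ⟨this, (IsIsotypicOfType.of_isotypicComponent_eq_top htop).isIsotypic⟩

end Isotypic

section SimpleModule

variable {R W : Type*} [Ring R] [AddCommGroup W] [Module R W] [IsSimpleModule R W]

theorem IsSimpleModule.exists_smul_eq {w : W} (hw : w ≠ 0) (w' : W) : ∃ r : R, r • w = w' :=
  IsSimpleModule.toSpanSingleton_surjective R hw w'

theorem IsSimpleModule.exists_end_apply_eq {w w' : W} (hw : w ≠ 0)
    (h : ∀ r : R, r • w = 0 → r • w' = 0) : ∃ φ : Module.End R W, φ w = w' := by
  have hs := IsSimpleModule.toSpanSingleton_surjective R hw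
  let e := (LinearMap.toSpanSingleton R W w).quotKerEquivOfSurjective hs
  let g := (LinearMap.ker (LinearMap.toSpanSingleton R W w)).liftQ
    (LinearMap.toSpanSingleton R W w') (fun r hr => h r hr)
  refine ⟨g ∘ₗ e.symm.toLinearMap, ?_⟩
  have : e.symm w = Submodule.Quotient.mk 1 := by
    rw [LinearEquiv.symm_apply_eq]
    change w = (LinearMap.toSpanSingleton R W w) 1
    simp
  simp only [LinearMap.comp_apply, LinearEquiv.coe_coe, this]
  change (LinearMap.toSpanSingleton R W w') 1 = w'
  simp

/-- The nonzero vectors of a finite simple module are equidistributed over their annihilators. -/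
theorem IsSimpleModule.card_ne_zero_eq [Finite W] :
    Nat.card {w : W // w ≠ 0} =
      Nat.card {J : Set R // ∃ w : W, w ≠ 0 ∧ J = {r | r • w = 0}} *
        Nat.card {φ : Module.End R W // φ ≠ 0} := by
  classical
  set X := {w : W // w ≠ 0}
  set Y := {J : Set R // ∃ w : W, w ≠ 0 ∧ J = {r | r • w = 0}}
  let π : X → Y := fun w => ⟨{r | r • (w : W) = 0}, w, w.2, rfl⟩
  have hπ : Function.Surjective π := by
    rintro ⟨J, w, hw, rfl⟩
    exact ⟨⟨w, hw⟩, rfl⟩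
  have : Finite Y := Finite.of_surjective π hπ
  have hfib : ∀ J : Y, Nat.card {w : X // π w = J} = Nat.card {φ : Module.End R W // φ ≠ 0} := by
    intro J
    obtain ⟨⟨w, hw⟩, rfl⟩ := hπ J
    symm
    have hinj : ∀ φ : Module.End R W, φ ≠ 0 → Function.Injective φ := fun φ hφ =>
      LinearMap.injective_of_ne_zero hφ
    let f : {φ : Module.End R W // φ ≠ 0} → {x : X // π x = π ⟨w, hw⟩} := fun φ =>
      ⟨⟨φ.1 w, fun h => hw (hinj φ.1 φ.2 (by rw [h, map_zero]))⟩, by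
        refine Subtype.ext (Set.ext fun r => ?_)
        change r • φ.1 w = 0 ↔ r • w = 0
        rw [← map_smul]
        exact ⟨fun h => hinj φ.1 φ.2 (by rw [h, map_zero]), fun h => by rw [h, map_zero]⟩⟩
    refine Nat.card_congr (Equiv.ofBijective f ⟨?_, ?_⟩)
    · rintro ⟨φ, hφ⟩ ⟨ψ, hψ⟩ h
      have h' : φ w = ψ w := congrArg (fun x => x.1.1) h
      by_contra hne
      have hsub : φ - ψ ≠ 0 := fun h0 => hne (Subtype.ext (sub_eq_zero.1 h0))
      exact hw (hinj _ hsub (by simp [h']))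
    · rintro ⟨⟨w', hw'⟩, h⟩
      have h' : ∀ r : R, r • w' = 0 ↔ r • w = 0 := fun r =>
        Set.ext_iff.1 (congrArg Subtype.val h) r
      obtain ⟨φ, hφ⟩ := IsSimpleModule.exists_end_apply_eq hw fun r => (h' r).2
      refine ⟨⟨φ, ?_⟩, Subtype.ext (Subtype.ext hφ)⟩
      rintro rfl
      exact hw' hφ.symm
  rw [← Nat.card_congr (Equiv.sigmaFiberEquiv π)]
  have := Fintype.ofFinite Y
  rw [Nat.card_sigma, Finset.sum_congr rfl fun J _ => hfib J, Finset.sum_const, Finset.card_univ,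
    smul_eq_mul, Nat.card_eq_fintype_card (α := Y)]

end SimpleModule

theorem Nat.card_ne_zero_eq {W : Type*} [Zero W] [Finite W] :
    Nat.card {w : W // w ≠ 0} = Nat.card W - 1 := by
  classical
  have := Fintype.ofFinite W
  rw [Nat.card_eq_fintype_card, Nat.card_eq_fintype_card, Fintype.card_subtype_compl,
    Fintype.card_subtype_eq]

section Semilinear

variable {R V : Type*} [Ring R] [AddCommGroup V] [Module R V] {σ σ' : R →+* R}
  [RingHomInvPair σ σ'] [RingHomInvPair σ' σ]

theorem SemilinearEquiv.smul_apply_eq_zero_iff (L : V ≃ₛₗ[σ] V) (r : R) (v : V) :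
    r • L v = 0 ↔ σ' r • v = 0 := by
  have : r • L v = L (σ' r • v) := by
    rw [map_smulₛₗ, RingHomInvPair.comp_apply_eq₂]
  rw [this, map_eq_zero_iff L L.injective]

/-- A semilinear automorphism of prime order of an isotypic module fixes the annihilator of some
nonzero vector of a simple submodule, unless the number of nonzero vectors there is divisible
by that prime. -/
theorem IsIsotypic.exists_annihilator_fixed (hiso : IsIsotypic R V) (L : V ≃ₛₗ[σ] V) {p : ℕ}
    (hp : p.Prime) (hL : ∀ v, L^[p] v = v) (W : Submodule R V) [IsSimpleModule R W] [Finite W]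
    (hcard : ¬ p ∣ Nat.card {w : W // w ≠ 0}) :
    ∃ w ∈ W, w ≠ 0 ∧ ∀ r : R, σ' r • w = 0 ↔ r • w = 0 := by
  rw [IsSimpleModule.card_ne_zero_eq (R := R)] at hcard
  set Y := {J : Set R // ∃ w : W, w ≠ 0 ∧ J = {r | r • w = 0}} with hY
  have : Finite Y := Finite.of_surjective
    (fun w : {w : W // w ≠ 0} => (⟨{r | r • (w : W) = 0}, w, w.2, rfl⟩ : Y)) (by
      rintro ⟨J, w, hw, rfl⟩
      exact ⟨⟨w, hw⟩, rfl⟩)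
  let T : Y → Y := fun J => ⟨{r | σ' r ∈ J.1}, by
    obtain ⟨J, w, hw, rfl⟩ := J
    have := isSimpleModule_map L W
    obtain ⟨ψ⟩ := hiso W (W.map (L : V →ₛₗ[σ] V))
    set x : W.map (L : V →ₛₗ[σ] V) := ⟨L w, w, w.2, rfl⟩
    have hx : x ≠ 0 := by
      intro h
      have h' : L (w : V) = 0 := congrArg Subtype.val h
      exact hw (Subtype.ext ((map_eq_zero_iff L L.injective).1 h'))
    refine ⟨ψ x, fun h => hx ((map_eq_zero_iff ψ ψ.injective).1 h), ?_⟩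
    ext r
    simp only [Set.mem_ofPred_eq]
    rw [← map_smul, map_eq_zero_iff ψ ψ.injective, Subtype.ext_iff, Subtype.ext_iff]
    exact (SemilinearEquiv.smul_apply_eq_zero_iff L r w).symm⟩
  have hTn : ∀ n (J : Y) (v : V), J.1 = {r : R | r • v = 0} →
      (T^[n] J).1 = {r : R | r • (L^[n] v) = 0} := by
    intro n
    induction n with
    | zero => intro J v h; exact h
    | succ n ih =>
      intro J v h
      rw [Function.iterate_succ_apply, Function.iterate_succ_apply]
      refine ih _ _ ?_
      ext r
      change σ' r ∈ J.1 ↔ _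
      rw [h]
      exact (SemilinearEquiv.smul_apply_eq_zero_iff L r v).symm
  have hmem : ∀ (w : W) (r : R), r • w = 0 ↔ r • (w : V) = 0 := fun w r => by
    rw [Subtype.ext_iff]; rfl
  obtain ⟨⟨J, w, hw, hJw⟩, hJ⟩ := exists_fixed_point_of_iterate hp
    (fun h => hcard (h.mul_right _)) T (by
      rintro ⟨J, w, hw, rfl⟩
      refine Subtype.ext ?_
      have h0 : ({r : R | r • w = 0} : Set R) = {r : R | r • (w : V) = 0} :=
        Set.ext fun r => hmem w r
      exact (hTn p _ w h0).trans (by rw [hL]; exact h0.symm))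
  refine ⟨w, w.2, fun h => hw (Subtype.ext h), fun r => ?_⟩
  have h1 : σ' r ∈ J ↔ r ∈ J := Set.ext_iff.1 (congrArg Subtype.val hJ) r
  rw [hJw] at h1
  rw [← hmem, ← hmem]
  exact h1

end Semilinear

section Dichotomy

variable {V : Type*} [AddCommGroup V] [Module (ZMod 2) V] [FiniteDimensional (ZMod 2) V]
  {R : Subalgebra (ZMod 2) (Module.End (ZMod 2) V)} {σ σ' : R →+* R}
  [RingHomInvPair σ σ'] [RingHomInvPair σ' σ]

theorem Subalgebra.card_submodule_eq (W : Submodule R V) :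
    Nat.card W = 2 ^ Module.finrank (ZMod 2) (W.restrictScalars (ZMod 2)) := by
  have := Module.natCard_eq_pow_finrank (K := ZMod 2) (V := W.restrictScalars (ZMod 2))
  rwa [Nat.card_zmod] at this

/-- A semilinear automorphism `L` of order 11 without nontrivial stable subspaces in dimension 10
forces `V` to be simple over `R`, unless `R` is a division algebra. -/
theorem isSimpleModule_or_injective (L : V ≃ₛₗ[σ] V) (hdim : Module.finrank (ZMod 2) V = 10)
    (hL : ∀ v, L^[11] v = v)
    (hirr : ∀ U : Submodule (ZMod 2) V, (∀ u ∈ U, L u ∈ U) → U = ⊥ ∨ U = ⊤) :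
    IsSimpleModule R V ∨ ∀ r ∈ R, r ≠ 0 → Function.Injective r := by
  have : Nontrivial V := Module.nontrivial_of_finrank_pos (R := ZMod 2) (by omega)
  have : Finite V := Module.finite_of_finite (ZMod 2)
  have : IsArtinian R V := isArtinian_of_tower (ZMod 2) inferInstance
  obtain ⟨-, hiso⟩ := isIsotypic_of_semilinearEquiv L (by norm_num : Nat.Prime 11)
    (by omega) hL hirr
  obtain ⟨W, hW⟩ := IsAtomic.exists_atom (Submodule R V)
  by_cases htop : W = ⊤
  · left
    rw [← isSimpleModule_iff_isAtom] at hW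
    subst htop
    exact IsSimpleModule.congr (N := (⊤ : Submodule R V)) Submodule.topEquiv.symm
  right
  rw [← isSimpleModule_iff_isAtom] at hW
  have hcard : ¬ 11 ∣ Nat.card {w : W // w ≠ 0} := by
    rw [Nat.card_ne_zero_eq, Subalgebra.card_submodule_eq]
    refine not_eleven_dvd_two_pow_sub_one ?_ ?_
    · have := IsSimpleModule.nontrivial R W
      have : Nontrivial (W.restrictScalars (ZMod 2)) := this
      exact Module.finrank_pos
    · rw [← hdim]
      refine Submodule.finrank_lt ?_
      rwa [Ne, Submodule.restrictScalars_eq_top_iff]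
  obtain ⟨w, hw, hw0, hfix⟩ := hiso.exists_annihilator_fixed L (by norm_num : Nat.Prime 11) hL W
    hcard
  let U : Submodule (ZMod 2) V :=
    { carrier := {v | ∀ r : R, r • w = 0 → r • v = 0}
      zero_mem' := fun r _ => smul_zero r
      add_mem' := fun {a b} ha hb r hr => by rw [smul_add, ha r hr, hb r hr, add_zero]
      smul_mem' := fun a v hv r hr => by rw [smul_comm, hv r hr, smul_zero] }
  have hU : U = ⊤ := by
    refine (hirr U fun u hu r hr => ?_).resolve_left fun h => hw0 ?_
    · rw [SemilinearEquiv.smul_apply_eq_zero_iff]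
      exact hu _ ((hfix r).2 hr)
    · have hwU : w ∈ U := fun r hr => hr
      rw [h] at hwU
      exact (Submodule.mem_bot _).1 hwU
  have hJ0 : ∀ r : R, r • w = 0 → r = 0 := by
    intro r hr
    refine Subtype.ext (LinearMap.ext fun v => ?_)
    have : v ∈ U := hU ▸ Submodule.mem_top
    exact this r hr
  intro r hr hr0
  have hrw : (⟨⟨r, hr⟩ • w, W.smul_mem _ hw⟩ : W) ≠ 0 := fun h =>
    hr0 (congrArg Subtype.val (hJ0 ⟨r, hr⟩ (congrArg Subtype.val h)))
  obtain ⟨s, hs⟩ := IsSimpleModule.exists_smul_eq (R := R) (W := W) hrw ⟨w, hw⟩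
  have hs0 : s • (⟨r, hr⟩ : R) • w = w := congrArg Subtype.val hs
  have hs' : s * ⟨r, hr⟩ = 1 := by
    rw [← sub_eq_zero]
    refine hJ0 _ ?_
    rw [sub_smul, one_smul, mul_smul, hs0, sub_self]
  refine Function.LeftInverse.injective (g := (s : Module.End (ZMod 2) V)) fun v => ?_
  exact LinearMap.congr_fun (congrArg Subtype.val hs') v

end Dichotomy

section Conjugation

variable {F V G : Type*} [Field F] [AddCommGroup V] [Module F V] [Group G]

theorem Representation.inv_mul_self_apply (ρ : Representation F G V) (g : G) : ρ g⁻¹ * ρ g = 1 := by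
  rw [← map_mul, inv_mul_cancel, map_one]

theorem Representation.self_mul_inv_apply (ρ : Representation F G V) (g : G) : ρ g * ρ g⁻¹ = 1 := by
  rw [← map_mul, mul_inv_cancel, map_one]

/-- Conjugation by `ρ g` on a stable subalgebra. -/
def Representation.conjSubalgebra (ρ : Representation F G V) (R : Subalgebra F (Module.End F V))
    (hR : ∀ σ : G, ∀ r ∈ R, ρ σ * r * ρ σ⁻¹ ∈ R) (g : G) : R ≃ₐ[F] R :=
  AlgEquiv.ofAlgHom
    { toFun := fun r => ⟨ρ g * r * ρ g⁻¹, hR g r r.2⟩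
      map_one' := Subtype.ext (by simp [ρ.self_mul_inv_apply])
      map_mul' := fun a b => Subtype.ext (by
        change ρ g * (a * b : Module.End F V) * ρ g⁻¹ = (ρ g * a * ρ g⁻¹) * (ρ g * b * ρ g⁻¹)
        calc _ = ρ g * a * 1 * b * ρ g⁻¹ := by simp only [mul_assoc, one_mul]
          _ = _ := by rw [← ρ.inv_mul_self_apply g]; simp only [mul_assoc])
      map_zero' := Subtype.ext (by simp)
      map_add' := fun a b => Subtype.ext (by simp [mul_add, add_mul])
      commutes' := fun a => Subtype.ext (by
        change ρ g * algebraMap F (Module.End F V) a * ρ g⁻¹ = algebraMap F (Module.End F V) a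
        rw [← Algebra.commutes, mul_assoc, ρ.self_mul_inv_apply, mul_one]) }
    { toFun := fun r => ⟨ρ g⁻¹ * r * ρ g, by simpa using hR g⁻¹ r r.2⟩
      map_one' := Subtype.ext (by simp [ρ.inv_mul_self_apply])
      map_mul' := fun a b => Subtype.ext (by
        change ρ g⁻¹ * (a * b : Module.End F V) * ρ g = (ρ g⁻¹ * a * ρ g) * (ρ g⁻¹ * b * ρ g)
        calc _ = ρ g⁻¹ * a * 1 * b * ρ g := by simp only [mul_assoc, one_mul]
          _ = _ := by rw [← ρ.self_mul_inv_apply g]; simp only [mul_assoc])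
      map_zero' := Subtype.ext (by simp)
      map_add' := fun a b => Subtype.ext (by simp [mul_add, add_mul])
      commutes' := fun a => Subtype.ext (by
        change ρ g⁻¹ * algebraMap F (Module.End F V) a * ρ g = algebraMap F (Module.End F V) a
        rw [← Algebra.commutes, mul_assoc, ρ.inv_mul_self_apply, mul_one]) }
    (by
      ext1 r
      refine Subtype.ext ?_
      change ρ g * (ρ g⁻¹ * r * ρ g) * ρ g⁻¹ = (r : Module.End F V)
      rw [mul_assoc, mul_assoc (_ * _), ρ.self_mul_inv_apply, ← mul_assoc, ← mul_assoc,
        ρ.self_mul_inv_apply, one_mul, mul_one])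
    (by
      ext1 r
      refine Subtype.ext ?_
      change ρ g⁻¹ * (ρ g * r * ρ g⁻¹) * ρ g = (r : Module.End F V)
      rw [mul_assoc, mul_assoc (_ * _), ρ.inv_mul_self_apply, ← mul_assoc, ← mul_assoc,
        ρ.inv_mul_self_apply, one_mul, mul_one])

theorem Representation.coe_conjSubalgebra_apply (ρ : Representation F G V)
    (R : Subalgebra F (Module.End F V)) (hR : ∀ σ : G, ∀ r ∈ R, ρ σ * r * ρ σ⁻¹ ∈ R) (g : G)
    (r : R) : (ρ.conjSubalgebra R hR g r : Module.End F V) = ρ g * r * ρ g⁻¹ := rfl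

theorem Representation.coe_conjSubalgebra_pow_apply (ρ : Representation F G V)
    (R : Subalgebra F (Module.End F V)) (hR : ∀ σ : G, ∀ r ∈ R, ρ σ * r * ρ σ⁻¹ ∈ R) (g : G)
    (n : ℕ) (r : R) :
    (((ρ.conjSubalgebra R hR g) ^ n) r : Module.End F V) = ρ (g ^ n) * r * ρ (g ^ n)⁻¹ := by
  induction n with
  | zero => simp
  | succ n ih =>
    rw [pow_succ', AlgEquiv.mul_apply, ρ.coe_conjSubalgebra_apply, ih, pow_succ', mul_inv_rev,
      map_mul, map_mul]
    simp only [mul_assoc]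

/-- The action of `ρ g`, semilinear over a stable subalgebra. -/
def Representation.semilinearEquiv (ρ : Representation F G V)
    (R : Subalgebra F (Module.End F V)) (hR : ∀ σ : G, ∀ r ∈ R, ρ σ * r * ρ σ⁻¹ ∈ R) (g : G) :
    letI e := (ρ.conjSubalgebra R hR g).toRingEquiv
    letI := RingHomInvPair.of_ringEquiv e
    letI := RingHomInvPair.symm (e : R →+* R) (e.symm : R →+* R)
    V ≃ₛₗ[(e : R →+* R)] V :=
  letI e := (ρ.conjSubalgebra R hR g).toRingEquiv
  letI := RingHomInvPair.of_ringEquiv e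
  letI := RingHomInvPair.symm (e : R →+* R) (e.symm : R →+* R)
  { toFun := ρ g
    invFun := ρ g⁻¹
    map_add' := map_add _
    map_smul' := fun r v => by
      change ρ g (r.1 v) = (ρ g * r.1 * ρ g⁻¹) (ρ g v)
      change _ = (ρ g * r.1) ((ρ g⁻¹ * ρ g) v)
      rw [ρ.inv_mul_self_apply]
      rfl
    left_inv := fun v => LinearMap.congr_fun (ρ.inv_mul_self_apply g) v
    right_inv := fun v => LinearMap.congr_fun (ρ.self_mul_inv_apply g) v }

theorem Representation.iterate_apply (ρ : Representation F G V) (g : G) (n : ℕ) (v : V) :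
    (ρ g)^[n] v = ρ (g ^ n) v := by
  rw [map_pow, Module.End.pow_apply]

theorem Representation.conj_mem_centralizer (ρ : Representation F G V)
    (R : Subalgebra F (Module.End F V)) (hR : ∀ σ : G, ∀ r ∈ R, ρ σ * r * ρ σ⁻¹ ∈ R) (g : G)
    (a : Module.End F V) (ha : a ∈ Subalgebra.centralizer F (R : Set (Module.End F V))) :
    ρ g * a * ρ g⁻¹ ∈ Subalgebra.centralizer F (R : Set (Module.End F V)) := by
  rw [Subalgebra.mem_centralizer_iff] at ha ⊢
  intro r hr
  have h := ha _ (hR g⁻¹ r hr)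
  rw [inv_inv] at h
  calc r * (ρ g * a * ρ g⁻¹) = (ρ g * ρ g⁻¹) * r * ρ g * a * ρ g⁻¹ := by
        rw [ρ.self_mul_inv_apply]; simp only [mul_assoc, one_mul]
    _ = ρ g * ((ρ g⁻¹ * r * ρ g) * a) * ρ g⁻¹ := by simp only [mul_assoc]
    _ = ρ g * (a * (ρ g⁻¹ * r * ρ g)) * ρ g⁻¹ := by rw [h]
    _ = ρ g * a * ρ g⁻¹ * r * (ρ g * ρ g⁻¹) := by simp only [mul_assoc]
    _ = _ := by rw [ρ.self_mul_inv_apply, mul_one]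

end Conjugation

section Density

variable {F V : Type*} [Field F] [AddCommGroup V] [Module F V] (R : Subalgebra F (Module.End F V))

theorem Subalgebra.injective_of_mem_centralizer [IsSimpleModule R V] {a : Module.End F V}
    (ha : a ∈ Subalgebra.centralizer F (R : Set (Module.End F V))) (h0 : a ≠ 0) :
    Function.Injective a := by
  let a' : V →ₗ[R] V :=
    { toFun := a
      map_add' := map_add a
      map_smul' := fun r v =>
        (LinearMap.congr_fun ((Subalgebra.mem_centralizer_iff F).1 ha r.1 r.2) v).symm }
  have h : a' ≠ 0 := fun h => h0 (LinearMap.ext fun v => LinearMap.congr_fun h v)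
  exact LinearMap.injective_of_ne_zero (R := R) (M := V) (N := V) (f := a') h

theorem Subalgebra.eq_top_of_centralizer_eq_bot [Finite V] [IsSimpleModule R V]
    (h : Subalgebra.centralizer F (R : Set (Module.End F V)) = ⊥) : R = ⊤ := by
  rw [eq_top_iff]
  intro f _
  let f' : Module.End (Module.End R V) V :=
    { toFun := f
      map_add' := map_add f
      map_smul' := fun a v => by
        have ha : a.restrictScalars F ∈ Subalgebra.centralizer F (R : Set (Module.End F V)) := by
          rw [Subalgebra.mem_centralizer_iff]
          intro r hr
          ext v
          exact (a.map_smul ⟨r, hr⟩ v).symm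
        rw [h, Algebra.mem_bot] at ha
        obtain ⟨x, hx⟩ := ha
        have hx' : ∀ v, a v = x • v := fun v => (LinearMap.congr_fun hx v).symm
        change f (a v) = a (f v)
        rw [hx', hx', map_smul] }
  have := Fintype.ofFinite V
  obtain ⟨r, hr⟩ := jacobson_density (R := R) f' Finset.univ
  have : f = r := LinearMap.ext fun v => hr v (Finset.mem_univ v)
  rw [this]
  exact r.2

end Density

theorem isVerySimple_of_division {V G : Type*} [AddCommGroup V] [Module (ZMod 2) V] [Group G]
    (ρ : Representation (ZMod 2) G V) (hdim : Module.finrank (ZMod 2) V = 10) (g : G)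
    (hg : g ^ 11 = 1)
    (hirr : ∀ U : Submodule (ZMod 2) V, (∀ u ∈ U, ρ g u ∈ U) → U = ⊥ ∨ U = ⊤)
    (hdiv : ∀ A : Subalgebra (ZMod 2) (Module.End (ZMod 2) V),
      (∀ σ : G, ∀ a ∈ A, ρ σ * a * ρ σ⁻¹ ∈ A) → (∀ a ∈ A, a ≠ 0 → Function.Injective a) → A = ⊥) :
    IsVerySimple ρ := by
  intro R hR
  have : FiniteDimensional (ZMod 2) V := Module.finite_of_finrank_pos (by omega)
  have : Finite V := Module.finite_of_finite (ZMod 2)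
  let e := (ρ.conjSubalgebra R hR g).toRingEquiv
  let := RingHomInvPair.of_ringEquiv e
  let := RingHomInvPair.symm (e : R →+* R) (e.symm : R →+* R)
  have hL : ∀ v, (ρ.semilinearEquiv R hR g)^[11] v = v := fun v => by
    change (ρ g)^[11] v = v
    rw [ρ.iterate_apply, hg, map_one]
    rfl
  rcases isSimpleModule_or_injective (ρ.semilinearEquiv R hR g) hdim hL hirr with h | h
  · right
    refine Subalgebra.eq_top_of_centralizer_eq_bot R (hdiv _ (ρ.conj_mem_centralizer R hR) ?_)
    exact fun a ha h0 => Subalgebra.injective_of_mem_centralizer R ha h0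
  · left
    exact hdiv R hR h

universe u in
theorem Finite.exists_field_ringEquiv {A : Type u} [Ring A] [Finite A] [IsDomain A] :
    ∃ (K : Type u) (_ : Field K), Nonempty (K ≃+* A) :=
  ⟨A, (Finite.isDomain_to_isField A).toField, ⟨{ Equiv.refl A with
    map_mul' := fun _ _ => rfl
    map_add' := fun _ _ => rfl }⟩⟩

theorem FiniteField.exists_algEquiv_eq_pow (K : Type*) [Field K] [Finite K] [Algebra (ZMod 2) K]
    (τ : K ≃ₐ[ZMod 2] K) : ∃ j : ℕ, ∀ x, τ x = x ^ 2 ^ j := by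
  obtain ⟨j, hj⟩ := (FiniteField.bijective_frobeniusAlgEquivOfAlgebraic_pow (ZMod 2) K).2 τ
  refine ⟨j, fun x => ?_⟩
  rw [← hj]
  simp only [AlgEquiv.coe_pow, FiniteField.coe_frobeniusAlgEquivOfAlgebraic_iterate, ZMod.card]

theorem ncard_pow_eq_self_le (L : Type*) [Field L] {q : ℕ} (hq : 1 < q) :
    {x : L | x ^ q = x}.Finite ∧ {x : L | x ^ q = x}.ncard ≤ q := by
  classical
  have h0 : (Polynomial.X ^ q - Polynomial.X : Polynomial L) ≠ 0 :=
    FiniteField.X_pow_card_sub_X_ne_zero L hq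
  have hd : (Polynomial.X ^ q - Polynomial.X : Polynomial L).natDegree = q :=
    FiniteField.X_pow_card_sub_X_natDegree_eq L hq
  have hs : {x : L | x ^ q = x} =
      (Polynomial.X ^ q - Polynomial.X : Polynomial L).roots.toFinset := by
    ext x
    simp [h0, sub_eq_zero]
  rw [hs]
  refine ⟨Finset.finite_toSet _, ?_⟩
  rw [Set.ncard_coe_finset]
  exact (Multiset.toFinset_card_le _).trans ((Polynomial.card_roots' _).trans_eq hd)

section Division

variable {V G : Type*} [AddCommGroup V] [Module (ZMod 2) V] [Group G]

theorem Subalgebra.isDomain_of_injective [Nontrivial V]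
    {A : Subalgebra (ZMod 2) (Module.End (ZMod 2) V)}
    (hinj : ∀ a ∈ A, a ≠ 0 → Function.Injective a) : IsDomain A := by
  have : NoZeroDivisors A := ⟨fun {a b} h => by
    by_contra! hab
    obtain ⟨ha, hb⟩ := hab
    refine hb (Subtype.ext (LinearMap.ext fun v => ?_))
    refine hinj a a.2 (fun h => ha (Subtype.ext h)) ?_
    have := LinearMap.congr_fun (congrArg Subtype.val h) v
    exact this.trans (map_zero _).symm⟩
  exact NoZeroDivisors.to_isDomain A

/-- A finite division algebra `A` in `End V` is a field of `2 ^ n` elements with `n ∣ dim V`, and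
every stable conjugation acts on it by a power of the Frobenius map. -/
theorem exists_card_eq_and_conj_eq_pow [FiniteDimensional (ZMod 2) V] [Nontrivial V]
    (ρ : Representation (ZMod 2) G V)
    (A : Subalgebra (ZMod 2) (Module.End (ZMod 2) V))
    (hA : ∀ σ : G, ∀ a ∈ A, ρ σ * a * ρ σ⁻¹ ∈ A)
    (hinj : ∀ a ∈ A, a ≠ 0 → Function.Injective a) :
    ∃ n : ℕ, n ∣ Module.finrank (ZMod 2) V ∧ Nat.card A = 2 ^ n ∧ (∀ a ∈ A, a ^ 2 ^ n = a) ∧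
      ∀ h : G, ∃ j : ℕ, ∀ a ∈ A, ρ h * a * ρ h⁻¹ = a ^ 2 ^ j := by
  have : Finite A := Module.finite_of_finite (ZMod 2)
  have := Subalgebra.isDomain_of_injective hinj
  obtain ⟨K, _, ⟨e⟩⟩ := Finite.exists_field_ringEquiv (A := A)
  have : Finite K := Finite.of_equiv A e.symm.toEquiv
  let _ : Algebra (ZMod 2) K := (e.symm.toRingHom.comp (algebraMap (ZMod 2) A)).toAlgebra
  have hcard : Nat.card K = 2 ^ Module.finrank (ZMod 2) K := by
    rw [Module.natCard_eq_pow_finrank (K := ZMod 2) (V := K), Nat.card_zmod]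
  refine ⟨Module.finrank (ZMod 2) K, ?_, ?_, ?_, ?_⟩
  · let _ : Module K V := Module.compHom V (A.val.toRingHom.comp e.toRingHom)
    have : Finite V := Module.finite_of_finite (ZMod 2)
    have : Module.Finite K V := Module.Finite.of_finite
    have h1 := Module.natCard_eq_pow_finrank (K := ZMod 2) (V := V)
    have h2 := Module.natCard_eq_pow_finrank (K := K) (V := V)
    rw [h1, hcard, Nat.card_zmod, ← pow_mul] at h2
    exact ⟨_, Nat.pow_right_injective le_rfl h2⟩
  · rw [← hcard, Nat.card_congr e.toEquiv]
  · intro a ha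
    have h : (e.symm ⟨a, ha⟩) ^ 2 ^ Module.finrank (ZMod 2) K = e.symm ⟨a, ha⟩ := by
      have := Fintype.ofFinite K
      rw [← hcard, Nat.card_eq_fintype_card, FiniteField.pow_card]
    have h' := congrArg e h
    rw [map_pow, e.apply_symm_apply] at h'
    exact congrArg Subtype.val h'
  · intro h
    let τ : K ≃+* K := (e.trans (ρ.conjSubalgebra A hA h).toRingEquiv).trans e.symm
    let τ' : K ≃ₐ[ZMod 2] K := AlgEquiv.ofRingEquiv (f := τ) fun x => by
      have : (τ : K →+* K).comp (algebraMap (ZMod 2) K) = algebraMap (ZMod 2) K :=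
        Subsingleton.elim _ _
      exact RingHom.congr_fun this x
    obtain ⟨j, hj⟩ := FiniteField.exists_algEquiv_eq_pow K τ'
    refine ⟨j, fun a ha => ?_⟩
    have h1 : e.symm (ρ.conjSubalgebra A hA h (e (e.symm ⟨a, ha⟩))) = e.symm ⟨a, ha⟩ ^ 2 ^ j :=
      hj (e.symm ⟨a, ha⟩)
    rw [e.apply_symm_apply, ← map_pow] at h1
    exact congrArg Subtype.val (e.symm.injective h1)

/-- The exponents of the Gaussian periods of order 11 that generate the subfields of `𝔽₁₀₂₄` with
4 and with 32 elements. -/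
def periodExponents : Finset (Finset ℕ) := {{1, 3, 4, 5, 9}, {1, 10}}

theorem exists_period_conj (ρ : Representation (ZMod 2) G V)
    (hdim : Module.finrank (ZMod 2) V = 10) (g : G) (hg : g ^ 11 = 1)
    (hirr : ∀ U : Submodule (ZMod 2) V, (∀ u ∈ U, ρ g u ∈ U) → U = ⊥ ∨ U = ⊤)
    (A : Subalgebra (ZMod 2) (Module.End (ZMod 2) V))
    (hA : ∀ σ : G, ∀ a ∈ A, ρ σ * a * ρ σ⁻¹ ∈ A)
    (hinj : ∀ a ∈ A, a ≠ 0 → Function.Injective a) (hne : A ≠ ⊥) :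
    ∃ S ∈ periodExponents, ∀ h : G, ∃ j : ℕ,
      ρ h * (∑ i ∈ S, ρ g ^ i) * ρ h⁻¹ = ∑ i ∈ S, ρ g ^ (i * 2 ^ j) := by
  have : FiniteDimensional (ZMod 2) V := Module.finite_of_finrank_pos (by omega)
  have : Nontrivial V := Module.nontrivial_of_finrank_pos (R := ZMod 2) (by omega)
  have : Finite A := Module.finite_of_finite (ZMod 2)
  obtain ⟨n, hn, hcard, hfix, hconj⟩ := exists_card_eq_and_conj_eq_pow ρ A hA hinj
  rw [hdim] at hn
  have hn1 : n ≠ 1 := by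
    rintro rfl
    refine hne (Subalgebra.eq_bot_of_finrank_one ?_)
    rw [Module.natCard_eq_pow_finrank (K := ZMod 2) (V := A), Nat.card_zmod] at hcard
    exact Nat.pow_right_injective le_rfl hcard
  have hn0 : n ≠ 0 := by rintro rfl; norm_num at hn
  have hnle := Nat.le_of_dvd (by norm_num) hn
  have hcases : n = 2 ∨ n = 5 ∨ n = 10 := by
    interval_cases n <;> omega
  have hcop : Nat.gcd 11 n = 1 := by rcases hcases with rfl | rfl | rfl <;> rfl
  -- conjugation by `g` is trivial on `A`, having order prime to that of the Galois group
  have hcomm : ∀ a ∈ A, ρ g * a * ρ g⁻¹ = a := by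
    obtain ⟨j, hj⟩ := hconj g
    intro a ha
    let f : Module.End (ZMod 2) V → Module.End (ZMod 2) V := fun x => x ^ 2 ^ j
    have hfm : ∀ m, f^[m] a = a ^ (2 ^ j) ^ m := by
      intro m
      exact congrFun (pow_iterate (2 ^ j) m) a
    have h1 : Function.IsPeriodicPt f 11 a := by
      have : ∀ m, f^[m] a = (((ρ.conjSubalgebra A hA g) ^ m) ⟨a, ha⟩ : A) := by
        intro m
        induction m with
        | zero => rfl
        | succ m ih =>
          rw [Function.iterate_succ_apply', ih, pow_succ', AlgEquiv.mul_apply,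
            ρ.coe_conjSubalgebra_apply, hj _ (Subtype.prop _)]
      change f^[11] a = a
      rw [this, ρ.coe_conjSubalgebra_pow_apply, hg]
      simp
    have h2 : Function.IsPeriodicPt f n a := by
      change f^[n] a = a
      have hp : Function.IsPeriodicPt (fun x : Module.End (ZMod 2) V => x ^ 2 ^ n) j a := by
        exact Function.IsFixedPt.isPeriodicPt (hfix a ha) j
      change (fun x : Module.End (ZMod 2) V => x ^ 2 ^ n)^[j] a = a at hp
      rw [pow_iterate] at hp
      rw [hfm, ← pow_mul, mul_comm j, pow_mul]
      exact hp
    have h3 := h1.gcd h2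
    rw [hcop] at h3
    rw [hj a ha]
    exact h3
  have hcomm' : ∀ a ∈ A, ρ g * a = a * ρ g := fun a ha => by
    conv_rhs => rw [← hcomm a ha]
    rw [mul_assoc _ _ (ρ g), ρ.inv_mul_self_apply, mul_one]
  -- the centralizer of `ρ g` is a field
  set C := Subalgebra.centralizer (ZMod 2) {ρ g} with hC
  have hmemC : ∀ a, a ∈ C ↔ ρ g * a = a * ρ g := fun a => by
    simp [hC, Subalgebra.mem_centralizer_iff]
  have : IsDomain C := Subalgebra.isDomain_of_injective fun a ha h0 => by
    rw [← LinearMap.ker_eq_bot]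
    refine (hirr (LinearMap.ker a) fun u hu => ?_).resolve_right fun h =>
      h0 (LinearMap.ker_eq_top.1 h)
    rw [LinearMap.mem_ker] at hu ⊢
    have := LinearMap.congr_fun ((hmemC a).1 ha) u
    rw [Module.End.mul_apply, Module.End.mul_apply, hu, map_zero] at this
    exact this.symm
  have : Finite C := Module.finite_of_finite (ZMod 2)
  obtain ⟨L, _, ⟨ψ⟩⟩ := Finite.exists_field_ringEquiv (A := C)
  have : CharP L 2 := by
    let _ : Algebra (ZMod 2) L := (ψ.symm.toRingHom.comp (algebraMap (ZMod 2) C)).toAlgebra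
    exact charP_of_injective_algebraMap (algebraMap (ZMod 2) L).injective 2
  let φ : L →+* Module.End (ZMod 2) V := C.val.toRingHom.comp ψ.toRingHom
  have hφ : Function.Injective φ := Subtype.val_injective.comp ψ.injective
  have hφC : ∀ a ∈ C, ∃ x, φ x = a := fun a ha =>
    ⟨ψ.symm ⟨a, ha⟩, congrArg Subtype.val (ψ.apply_symm_apply ⟨a, ha⟩)⟩
  have hmem : ∀ x : L, x ^ 2 ^ n = x → φ x ∈ A := by
    obtain ⟨hfin, hle⟩ := ncard_pow_eq_self_le L (Nat.one_lt_two_pow hn0)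
    have hsub : {x : L | φ x ∈ A} ⊆ {x : L | x ^ 2 ^ n = x} := fun x hx =>
      hφ (by rw [map_pow]; exact hfix _ hx)
    have himg : φ '' {x : L | φ x ∈ A} = A := by
      ext a
      constructor
      · rintro ⟨x, hx, rfl⟩
        exact hx
      · intro ha
        obtain ⟨x, rfl⟩ := hφC a ((hmemC a).2 (hcomm' a ha))
        exact ⟨x, ha, rfl⟩
    have hc : {x : L | φ x ∈ A}.ncard = 2 ^ n := by
      rw [← Set.ncard_image_of_injective _ hφ, himg, ← hcard]
      rfl
    have heq := Set.eq_of_subset_of_ncard_le hsub (hle.trans hc.ge) hfin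
    intro x hx
    have : x ∈ {x : L | x ^ 2 ^ n = x} := hx
    rw [← heq] at this
    exact this
  obtain ⟨c, hc⟩ := hφC (ρ g) ((hmemC _).2 rfl)
  have hc11 : c ^ 11 = 1 := hφ (by rw [map_pow, hc, ← map_pow, hg, map_one, map_one])
  have hmod : ∀ k, c ^ k = c ^ (k % 11) := fun k => pow_eq_pow_mod k hc11
  have hpow : ∀ (S : Finset ℕ) (j : ℕ), (∑ i ∈ S, c ^ i) ^ 2 ^ j = ∑ i ∈ S, c ^ (i * 2 ^ j) :=
    fun S j => by
      rw [sum_pow_char_pow]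
      exact Finset.sum_congr rfl fun i _ => (pow_mul c i _).symm
  obtain ⟨S, hS, hSn⟩ : ∃ S ∈ periodExponents, (∑ i ∈ S, c ^ i) ^ 2 ^ n = ∑ i ∈ S, c ^ i := by
    rcases hcases with rfl | rfl | rfl
    · refine ⟨{1, 3, 4, 5, 9}, by simp [periodExponents], ?_⟩
      rw [hpow]
      simp only [hmod (_ * _)]
      simp
      ring
    · refine ⟨{1, 10}, by simp [periodExponents], ?_⟩
      rw [hpow]
      simp only [hmod (_ * _)]
      simp
      ring
    · refine ⟨{1, 10}, by simp [periodExponents], ?_⟩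
      rw [hpow]
      simp only [hmod (_ * _)]
      simp
  have hφS : φ (∑ i ∈ S, c ^ i) = ∑ i ∈ S, ρ g ^ i := by
    simp only [map_sum, map_pow, hc]
  refine ⟨S, hS, fun h => ?_⟩
  obtain ⟨j, hj⟩ := hconj h
  refine ⟨j, ?_⟩
  rw [← hφS, hj _ (hmem _ hSn), ← map_pow, hpow]
  simp only [map_sum, map_pow, hc]

end Division

theorem permRep_single {F B : Type*} [Field F] [DecidableEq B] (s : Perm B) (b : B) :
    permRep F B s (Pi.single b 1) = Pi.single (s b) 1 := by
  ext x
  rw [permRep_apply, Pi.single_apply, Pi.single_apply]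
  congr 1
  rw [Perm.inv_eq_iff_eq]

theorem coe_sumZeroRep_apply {F B : Type*} [Field F] [Fintype B] (s : Perm B) (v : sumZero F B) :
    (sumZeroRep F B s v : B → F) = permRep F B s v := rfl

theorem finrank_sumZero (F B : Type*) [Field F] [Fintype B] [Nonempty B] :
    Module.finrank F (sumZero F B) = Fintype.card B - 1 := by
  classical
  let f : (B → F) →ₗ[F] F := ∑ b, LinearMap.proj b
  have hf : ∀ h, f h = ∑ b, h b := fun h => by simp [f]
  have hker : sumZero F B = LinearMap.ker f := by
    ext h
    rw [mem_sumZero, LinearMap.mem_ker, hf]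
  have hrange : LinearMap.range f = ⊤ := by
    rw [LinearMap.range_eq_top]
    intro x
    refine ⟨Pi.single (Classical.arbitrary B) x, ?_⟩
    rw [hf]
    simp
  have h := LinearMap.finrank_range_add_finrank_ker f
  rw [hrange, finrank_top, Module.finrank_self, Module.finrank_fintype_fun_eq_card] at h
  rw [hker]
  omega

/-- The shift `x ↦ x + 1` of `ℤ/11`. -/
def shift : Perm (ZMod 11) := Equiv.addRight 1

theorem shift_apply (x : ZMod 11) : shift x = x + 1 := rfl

theorem shift_pow_apply (n : ℕ) (x : ZMod 11) : (shift ^ n) x = x + n := by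
  induction n with
  | zero => simp
  | succ n ih =>
    rw [pow_succ', Perm.mul_apply, ih, shift_apply]
    push_cast
    ring

theorem shift_pow_eleven : shift ^ 11 = 1 := by
  ext1 x
  rw [shift_pow_apply]
  have : ((11 : ℕ) : ZMod 11) = 0 := ZMod.natCast_self 11
  rw [this, add_zero, Perm.one_apply]

theorem ZMod.forall_of_forall_add_one {P : ZMod 11 → Prop} (h0 : P 0)
    (h : ∀ x, P x → P (x + 1)) (x : ZMod 11) : P x := by
  have key : ∀ n : ℕ, P n := by
    intro n
    induction n with
    | zero => simpa using h0
    | succ n ih => simpa using h _ ih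
  simpa using key x.val

theorem eq_bot_or_eq_top_of_shift (U : Submodule (ZMod 2) (sumZero (ZMod 2) (ZMod 11)))
    (hU : ∀ u ∈ U, sumZeroRep (ZMod 2) (ZMod 11) shift u ∈ U) : U = ⊥ ∨ U = ⊤ := by
  by_contra! h
  obtain ⟨hbot, htop⟩ := h
  have hfin : Finite U := Module.finite_of_finite (ZMod 2)
  have hcard : ¬ 11 ∣ Nat.card {u : U // u ≠ 0} := by
    have e : Nat.card U = 2 ^ Module.finrank (ZMod 2) U := by
      rw [Module.natCard_eq_pow_finrank (K := ZMod 2) (V := U), Nat.card_zmod]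
    rw [Nat.card_ne_zero_eq, e]
    refine not_eleven_dvd_two_pow_sub_one ?_ ?_
    · have := (Submodule.nontrivial_iff_ne_bot).2 hbot
      exact Module.finrank_pos
    · have := Submodule.finrank_lt htop
      rwa [finrank_sumZero, ZMod.card] at this
  let ρ := sumZeroRep (ZMod 2) (ZMod 11)
  have hinj : Function.Injective (ρ shift) := by
    refine Function.LeftInverse.injective (g := ρ shift⁻¹) fun v => ?_
    exact LinearMap.congr_fun (ρ.inv_mul_self_apply shift) v
  let f : {u : U // u ≠ 0} → {u : U // u ≠ 0} := fun u =>
    ⟨⟨ρ shift u.1, hU _ u.1.2⟩, fun h => u.2 (Subtype.ext (hinj (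
      (congrArg Subtype.val h).trans (map_zero _).symm)))⟩
  have hf : ∀ n u, ((f^[n] u).1 : sumZero (ZMod 2) (ZMod 11)) = ρ (shift ^ n) u.1 := by
    intro n u
    induction n with
    | zero => simp
    | succ n ih =>
      rw [Function.iterate_succ_apply', pow_succ', map_mul, Module.End.mul_apply, ← ih]
  obtain ⟨⟨⟨u, hu⟩, hu0⟩, hfix⟩ := exists_fixed_point_of_iterate (by norm_num : Nat.Prime 11) hcard f
    (fun u => Subtype.ext (Subtype.ext (by rw [hf, shift_pow_eleven, map_one]; rfl)))
  have h1 : ρ shift u = u := congrArg (fun x => x.1.1) hfix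
  have h2 : ∀ x : ZMod 11, u.1 x = u.1 0 := by
    refine ZMod.forall_of_forall_add_one rfl fun x hx => ?_
    rw [← hx]
    have h3 : u.1 (shift⁻¹ (x + 1)) = u.1 (x + 1) := congrFun (congrArg Subtype.val h1) (x + 1)
    rw [← h3, Perm.inv_eq_iff_eq.2 (shift_apply x).symm]
  have h3 : ∑ x, u.1 x = 0 := u.2
  rw [Finset.sum_congr rfl fun x _ => h2 x, Finset.sum_const, Finset.card_univ, ZMod.card,
    nsmul_eq_mul, show ((11 : ℕ) : ZMod 2) = 1 from rfl, one_mul] at h3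
  exact hu0 (Subtype.ext (Subtype.ext (funext fun x => (h2 x).trans h3)))

/-- An equality of operators `s (∑ c ^ i) s⁻¹ = ∑ c ^ (m i)` on `(𝔽₂^B)^0` is a combinatorial
statement about `s`. -/
theorem exists_apply_add_eq (s : Perm (ZMod 11)) {S : Finset ℕ} (hS : ∀ i ∈ S, i < 11) (m : ℕ)
    (h : sumZeroRep (ZMod 2) (ZMod 11) s * (∑ i ∈ S, sumZeroRep (ZMod 2) (ZMod 11) shift ^ i) *
      sumZeroRep (ZMod 2) (ZMod 11) s⁻¹ =
        ∑ i ∈ S, sumZeroRep (ZMod 2) (ZMod 11) shift ^ (i * m)) (b : ZMod 11) (i : ℕ)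
    (hi : i ∈ S) : ∃ k ∈ S, s (b + i) = s b + k * m := by
  let ρ := sumZeroRep (ZMod 2) (ZMod 11)
  let π := permRep (ZMod 2) (ZMod 11)
  have hcoe : ∀ (T : Finset ℕ) (a : ℕ → ℕ) (v : sumZero (ZMod 2) (ZMod 11)),
      (((∑ i ∈ T, ρ shift ^ a i) v : sumZero (ZMod 2) (ZMod 11)) : ZMod 11 → ZMod 2) =
        (∑ i ∈ T, π (shift ^ a i)) v := by
    intro T a v
    rw [LinearMap.sum_apply, LinearMap.sum_apply, Submodule.coe_sum]
    refine Finset.sum_congr rfl fun i _ => ?_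
    rw [← map_pow]
    rfl
  have h0 : ∀ f ∈ sumZero (ZMod 2) (ZMod 11),
      π s ((∑ i ∈ S, π (shift ^ i)) f) = (∑ i ∈ S, π (shift ^ (i * m))) (π s f) := by
    intro f hf
    have h1 := LinearMap.congr_fun h (ρ s ⟨f, hf⟩)
    have h2 : ρ s⁻¹ (ρ s ⟨f, hf⟩) = ⟨f, hf⟩ :=
      LinearMap.congr_fun (ρ.inv_mul_self_apply s) _
    rw [Module.End.mul_apply, Module.End.mul_apply, h2] at h1
    have h3 := congrArg Subtype.val h1
    rw [hcoe S (fun i => i * m) (ρ s ⟨f, hf⟩)] at h3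
    rw [coe_sumZeroRep_apply] at h3
    rw [hcoe S (fun i => i) ⟨f, hf⟩] at h3
    exact h3
  have h1 : π s ((∑ i ∈ S, π (shift ^ i)) 1) = (∑ i ∈ S, π (shift ^ (i * m))) (π s 1) := by
    have hone : ∀ t : Perm (ZMod 11), π t 1 = 1 := fun t => rfl
    simp only [LinearMap.sum_apply, hone, Finset.sum_const, map_nsmul]
  have h2 : ∀ f, π s ((∑ i ∈ S, π (shift ^ i)) f) = (∑ i ∈ S, π (shift ^ (i * m))) (π s f) := by
    intro f
    have hf : f - (∑ x, f x) • (1 : ZMod 11 → ZMod 2) ∈ sumZero (ZMod 2) (ZMod 11) := by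
      rw [mem_sumZero]
      simp only [Pi.sub_apply, Pi.smul_apply, Pi.one_apply, Finset.sum_sub_distrib,
        Finset.sum_const, Finset.card_univ, ZMod.card, smul_eq_mul, mul_one, nsmul_eq_mul]
      rw [show ((11 : ℕ) : ZMod 2) = 1 from rfl, one_mul, sub_self]
    have h3 := h0 _ hf
    rw [map_sub, map_sub, map_sub, map_sub, map_smul, map_smul, map_smul, map_smul, h1] at h3
    exact sub_left_inj.1 h3
  have h3 := h2 (Pi.single b 1)
  simp only [LinearMap.sum_apply, map_sum, π, permRep_single, shift_pow_apply] at h3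
  have h4 := congrFun h3 (s (b + i))
  simp only [Finset.sum_apply] at h4
  rw [Finset.sum_eq_single_of_mem i hi, Pi.single_eq_same] at h4
  · by_contra! hne
    rw [Finset.sum_eq_zero] at h4
    · exact one_ne_zero h4
    · intro k hk
      refine Pi.single_eq_of_ne ?_ _
      have := hne k hk
      push_cast
      exact this
  · intro k hk hki
    refine Pi.single_eq_of_ne (fun heq => hki ?_) _
    have h5 : ((i : ℕ) : ZMod 11) = k := add_left_cancel (s.injective heq)
    have h6 := congrArg ZMod.val h5
    rw [ZMod.val_natCast_of_lt (hS i hi), ZMod.val_natCast_of_lt (hS k hk)] at h6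
    exact h6.symm

theorem eq_one_of_neighbours (s : Perm (ZMod 11)) (h0 : s 0 = 0) (h1 : s 1 = 1)
    (h : ∀ b, s (b + 1) - s b = 1 ∨ s (b + 1) - s b = 10) : s = 1 := by
  have key : ∀ b, s b = b ∧ s (b + 1) = b + 1 := by
    refine ZMod.forall_of_forall_add_one ⟨h0, by simpa using h1⟩ fun b hb => ⟨hb.2, ?_⟩
    rcases h (b + 1) with h | h
    · rw [sub_eq_iff_eq_add.1 h, hb.2, add_comm]
    · rw [sub_eq_iff_eq_add, hb.2] at h
      have h2 : (10 : ZMod 11) + (b + 1) = b := by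
        rw [add_comm b, ← add_assoc, show (10 : ZMod 11) + 1 = 0 from rfl, zero_add]
      rw [h2] at h
      have h3 : b + (1 + 1) = b + 0 := by
        rw [← add_assoc, add_zero]
        exact s.injective (h.trans hb.1.symm)
      exact absurd (add_left_cancel h3) (by decide)
  exact Equiv.ext fun b => (key b).1

theorem eq_one_of_residues (s : Perm (ZMod 11)) (h0 : s 0 = 0) (h1 : s 1 = 1)
    (h : ∀ b, ∀ i ∈ ({1, 3, 4, 5, 9} : Finset (ZMod 11)),
      s (b + i) - s b ∈ ({1, 3, 4, 5, 9} : Finset (ZMod 11))) : s = 1 := by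
  have hdec : ∀ x y : ZMod 11, x ∈ ({1, 3, 4, 5, 9} : Finset (ZMod 11)) →
      x - 1 ∈ ({1, 3, 4, 5, 9} : Finset (ZMod 11)) →
      y ∈ ({1, 3, 4, 5, 9} : Finset (ZMod 11)) → y - 1 ∈ ({1, 3, 4, 5, 9} : Finset (ZMod 11)) →
      y - x ∈ ({1, 3, 4, 5, 9} : Finset (ZMod 11)) → x = 4 ∧ y = 5 := by decide
  have step : ∀ b, s b = b → s (b + 1) = b + 1 → s (b + 4) = b + 4 ∧ s (b + 5) = b + 5 := by
    intro b hb hb1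
    have a1 := h b 4 (by decide)
    have a2 := h (b + 1) 3 (by decide)
    have a3 := h b 5 (by decide)
    have a4 := h (b + 1) 4 (by decide)
    have a5 := h (b + 4) 1 (by decide)
    rw [hb1, add_assoc, show (1 : ZMod 11) + 3 = 4 from rfl, ← sub_sub] at a2
    rw [hb1, add_assoc, show (1 : ZMod 11) + 4 = 5 from rfl, ← sub_sub] at a4
    rw [add_assoc, show (4 : ZMod 11) + 1 = 5 from rfl] at a5
    rw [hb] at a1 a3
    obtain ⟨e1, e2⟩ := hdec (s (b + 4) - b) (s (b + 5) - b) a1 a2 a3 a4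
      (by rwa [sub_sub_sub_cancel_right])
    exact ⟨by rw [sub_eq_iff_eq_add.1 e1, add_comm], by rw [sub_eq_iff_eq_add.1 e2, add_comm]⟩
  have key : ∀ b, s (4 * b) = 4 * b ∧ s (4 * b + 1) = 4 * b + 1 := by
    refine ZMod.forall_of_forall_add_one ⟨by simpa using h0, by simpa using h1⟩ fun b hb => ?_
    have := step _ hb.1 hb.2
    rw [mul_add, mul_one, add_assoc, show (4 : ZMod 11) + 1 = 5 from rfl]
    exact this
  refine Equiv.ext fun b => ?_
  have := (key (3 * b)).1
  rwa [← mul_assoc, show (4 : ZMod 11) * 3 = 1 from rfl, one_mul] at this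

theorem eq_one_of_period {S : Finset ℕ} (hS : S ∈ periodExponents) (s : Perm (ZMod 11))
    (h0 : s 0 = 0) (h1 : s 1 = 1) (m : ℕ)
    (h : ∀ b : ZMod 11, ∀ i ∈ S, ∃ k ∈ S, s (b + i) = s b + k * m) : s = 1 := by
  simp only [periodExponents, Finset.mem_insert, Finset.mem_singleton] at hS
  rcases hS with rfl | rfl
  · obtain ⟨k, hk, hk1⟩ := h 0 1 (by decide)
    rw [h0, Nat.cast_one, zero_add, zero_add, h1] at hk1
    refine eq_one_of_residues s h0 h1 fun b i hi => ?_
    have hdec : ∀ m : ZMod 11, (∃ k ∈ ({1, 3, 4, 5, 9} : Finset ℕ), 1 = (k : ZMod 11) * m) →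
        ∀ k ∈ ({1, 3, 4, 5, 9} : Finset ℕ),
          (k : ZMod 11) * m ∈ ({1, 3, 4, 5, 9} : Finset (ZMod 11)) := by decide
    have hcast : ∀ i ∈ ({1, 3, 4, 5, 9} : Finset (ZMod 11)),
        ∃ k ∈ ({1, 3, 4, 5, 9} : Finset ℕ), (k : ZMod 11) = i := by decide
    obtain ⟨i, hi', rfl⟩ := hcast i hi
    obtain ⟨l, hl, hl1⟩ := h b i hi'
    rw [hl1, add_sub_cancel_left]
    exact hdec m ⟨k, hk, hk1⟩ l hl
  · obtain ⟨k, hk, hk1⟩ := h 0 1 (by decide)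
    rw [h0, Nat.cast_one, zero_add, zero_add, h1] at hk1
    refine eq_one_of_neighbours s h0 h1 fun b => ?_
    have hdec : ∀ m : ZMod 11, (∃ k ∈ ({1, 10} : Finset ℕ), 1 = (k : ZMod 11) * m) →
        ∀ k ∈ ({1, 10} : Finset ℕ), (k : ZMod 11) * m = 1 ∨ (k : ZMod 11) * m = 10 := by decide
    obtain ⟨l, hl, hl1⟩ := h b 1 (by decide)
    rw [Nat.cast_one] at hl1
    rw [hl1, add_sub_cancel_left]
    exact hdec m ⟨k, hk, hk1⟩ l hl

theorem card_le_of_pair_stabilizer (H : Subgroup (Perm (ZMod 11)))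
    (h : ∀ s ∈ H, s 0 = 0 → s 1 = 1 → s = 1) : Nat.card H ≤ 110 := by
  let f : H → {p : ZMod 11 × ZMod 11 // p.1 ≠ p.2} := fun s =>
    ⟨(s.1 0, s.1 1), fun h => absurd (s.1.injective h) (by decide)⟩
  have hf : Function.Injective f := by
    intro s t hst
    have h0 : s.1 0 = t.1 0 := congrArg (fun p => p.1.1) hst
    have h1 : s.1 1 = t.1 1 := congrArg (fun p => p.1.2) hst
    have h2 := h (t⁻¹ * s : H) (t⁻¹ * s : H).2
      (by change t.1⁻¹ (s.1 0) = 0; rw [Perm.inv_eq_iff_eq, h0])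
      (by change t.1⁻¹ (s.1 1) = 1; rw [Perm.inv_eq_iff_eq, h1])
    have h3 : t⁻¹ * s = 1 := Subtype.ext h2
    exact (inv_mul_eq_one.1 h3).symm
  refine (Nat.card_le_card_of_injective f hf).trans ?_
  rw [Nat.card_eq_fintype_card]
  decide

theorem isVerySimple_of_shift_mem (H : Subgroup (Perm (ZMod 11))) (hshift : shift ∈ H)
    (hcard : 110 < Nat.card H) :
    IsVerySimple ((sumZeroRep (ZMod 2) (ZMod 11)).comp H.subtype) := by
  have hdim : Module.finrank (ZMod 2) (sumZero (ZMod 2) (ZMod 11)) = 10 := by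
    rw [finrank_sumZero, ZMod.card]
  let g : H := ⟨shift, hshift⟩
  have hg : g ^ 11 = 1 := Subtype.ext shift_pow_eleven
  let ρ : Representation (ZMod 2) H (sumZero (ZMod 2) (ZMod 11)) :=
    (sumZeroRep (ZMod 2) (ZMod 11)).comp H.subtype
  refine isVerySimple_of_division ρ hdim g hg eq_bot_or_eq_top_of_shift fun A hA hinj => ?_
  by_contra hne
  obtain ⟨S, hS, hconj⟩ := exists_period_conj ρ hdim g hg eq_bot_or_eq_top_of_shift A hA hinj hne
  have hlt : ∀ S ∈ periodExponents, ∀ i ∈ S, i < 11 := by decide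
  refine absurd (card_le_of_pair_stabilizer H fun s hs h0 h1 => ?_) (not_le.2 hcard)
  obtain ⟨j, hj⟩ := hconj ⟨s, hs⟩
  exact eq_one_of_period hS s h0 h1 (2 ^ j) (exists_apply_add_eq s (hlt S hS) (2 ^ j) hj)

theorem IsVerySimple.of_linearEquiv {F G G' V V' : Type*} [Field F] [Group G] [Group G']
    [AddCommGroup V] [Module F V] [AddCommGroup V'] [Module F V'] {ρ : Representation F G V}
    {ρ' : Representation F G' V'} (e : V' ≃ₗ[F] V)
    (h : ∀ s : G', ∃ t : G, ∀ v, e (ρ' s v) = ρ t (e v)) (hρ : IsVerySimple ρ') :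
    IsVerySimple ρ := by
  intro R hR
  let ε : Module.End F V' ≃ₐ[F] Module.End F V := e.conjAlgEquiv F
  have hsurj : Function.Surjective ε := ε.surjective
  have hmap : (R.comap (ε : Module.End F V' →ₐ[F] Module.End F V)).map
      (ε : Module.End F V' →ₐ[F] Module.End F V) = R := by
    ext r
    simp only [Subalgebra.mem_map, Subalgebra.mem_comap]
    constructor
    · rintro ⟨a, ha, rfl⟩
      exact ha
    · intro hr
      obtain ⟨a, rfl⟩ := hsurj r
      exact ⟨a, hr, rfl⟩
  have hstab : ∀ s : G', ∀ r ∈ R.comap (ε : Module.End F V' →ₐ[F] Module.End F V),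
      ρ' s * r * ρ' s⁻¹ ∈ R.comap (ε : Module.End F V' →ₐ[F] Module.End F V) := by
    intro s r hr
    obtain ⟨t, ht⟩ := h s
    have ht' : ∀ v, e (ρ' s⁻¹ v) = ρ t⁻¹ (e v) := fun v => by
      have h1 := ht (ρ' s⁻¹ v)
      have h2 : ρ' s (ρ' s⁻¹ v) = v := LinearMap.congr_fun (ρ'.self_mul_inv_apply s) v
      have h3 : ρ t⁻¹ (ρ t (e (ρ' s⁻¹ v))) = e (ρ' s⁻¹ v) :=
        LinearMap.congr_fun (ρ.inv_mul_self_apply t) _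
      rw [← h3, ← h1, h2]
    rw [Subalgebra.mem_comap] at hr ⊢
    have h4 : (ε : Module.End F V' →ₐ[F] Module.End F V) (ρ' s * r * ρ' s⁻¹) =
        ρ t * (ε : Module.End F V' →ₐ[F] Module.End F V) r * ρ t⁻¹ := by
      ext v
      change e (ρ' s (r (ρ' s⁻¹ (e.symm v)))) = ρ t (e (r (e.symm (ρ t⁻¹ v))))
      rw [ht]
      congr 3
      rw [LinearEquiv.eq_symm_apply, ht', LinearEquiv.apply_symm_apply]
    rw [h4]
    exact hR t _ hr
  rcases hρ (R.comap (ε : Module.End F V' →ₐ[F] Module.End F V)) hstab with h0 | h0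
  · left
    rw [← hmap, h0, Algebra.map_bot]
  · right
    rw [← hmap, h0, Algebra.map_top, AlgHom.range_eq_top]
    exact hsurj

section ExtendByZero

variable (F : Type*) [Field F] {A B : Type*} [Fintype A] [Fintype B] (ι : A ↪ B)

/-- Extension by zero of functions with sum zero. -/
noncomputable def sumZeroExtend : sumZero F A →ₗ[F] sumZero F B :=
  LinearMap.restrict (Function.ExtendByZero.linearMap F ι) (p := sumZero F A) (q := sumZero F B)
    fun h hh => by
      rw [mem_sumZero] at hh ⊢
      rw [← hh]
      refine (Fintype.sum_of_injective ι ι.injective _ _ (fun b hb => ?_) fun a => ?_).symm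
      · exact Function.extend_apply' _ _ _ (fun ⟨a, ha⟩ => hb ⟨a, ha⟩)
      · exact (ι.injective.extend_apply _ _ a).symm

theorem sumZeroExtend_apply (h : sumZero F A) (a : A) : (sumZeroExtend F ι h).1 (ι a) = h.1 a :=
  ι.injective.extend_apply _ _ a

theorem sumZeroExtend_apply_of_notMem (h : sumZero F A) (b : B) (hb : b ∉ Set.range ι) :
    (sumZeroExtend F ι h).1 b = 0 :=
  Function.extend_apply' _ _ _ (fun ⟨a, ha⟩ => hb ⟨a, ha⟩)

theorem sumZeroExtend_injective : Function.Injective (sumZeroExtend F ι) := by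
  intro h k hk
  ext a
  rw [← sumZeroExtend_apply F ι, ← sumZeroExtend_apply F ι, hk]

theorem sumZeroExtend_map (s : Perm A) (t : Perm B) (ht : ∀ a, t (ι a) = ι (s a))
    (ht' : ∀ b ∉ Set.range ι, t b = b) (h : sumZero F A) :
    sumZeroExtend F ι (sumZeroRep F A s h) = sumZeroRep F B t (sumZeroExtend F ι h) := by
  refine Subtype.ext (funext fun b => ?_)
  rw [coe_sumZeroRep_apply, permRep_apply]
  by_cases hb : b ∈ Set.range ι
  · obtain ⟨a, rfl⟩ := hb
    have : t⁻¹ (ι a) = ι (s⁻¹ a) := by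
      rw [Perm.inv_eq_iff_eq, ht]
      exact congrArg ι (s.apply_symm_apply a).symm
    rw [this, sumZeroExtend_apply, sumZeroExtend_apply, coe_sumZeroRep_apply, permRep_apply]
  · have : t⁻¹ b = b := by rw [Perm.inv_eq_iff_eq, ht' b hb]
    rw [this, sumZeroExtend_apply_of_notMem F ι _ b hb, sumZeroExtend_apply_of_notMem F ι _ b hb]

theorem sumZeroExtend_surjective (hι : Function.Surjective ι) :
    Function.Surjective (sumZeroExtend F ι) := by
  intro v
  have hv : v.1 ∘ ι ∈ sumZero F A := by
    rw [mem_sumZero]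
    refine Eq.trans ?_ v.2
    exact Function.Bijective.sum_comp ⟨ι.injective, hι⟩ v.1
  refine ⟨⟨_, hv⟩, Subtype.ext (funext fun b => ?_)⟩
  obtain ⟨a, rfl⟩ := hι b
  exact sumZeroExtend_apply F ι _ a

/-- If the order of `B = A ∪ {∞}` is zero in `F`, then the heart of `F^B` is isomorphic to
`(F^A)^0`. -/
theorem mkQ_sumZeroExtend_bijective (b₀ : B) (hb₀ : ∀ b, b ∉ Set.range ι ↔ b = b₀)
    (hB : (Fintype.card B : F) = 0) :
    Function.Bijective ((constLine F B).mkQ ∘ₗ sumZeroExtend F ι) := by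
  have h0 : b₀ ∉ Set.range ι := (hb₀ b₀).2 rfl
  constructor
  · rw [← LinearMap.ker_eq_bot, LinearMap.ker_eq_bot']
    intro v hv
    rw [LinearMap.comp_apply, Submodule.mkQ_apply, Submodule.Quotient.mk_eq_zero] at hv
    obtain ⟨c, hc⟩ := Submodule.mem_span_singleton.1 (Submodule.mem_comap.1 hv)
    have h1 := congrFun hc b₀
    have h2 := sumZeroExtend_apply_of_notMem F ι v b₀ h0
    change c * 1 = (sumZeroExtend F ι v).1 b₀ at h1
    rw [h2, mul_one] at h1
    rw [h1, zero_smul] at hc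
    refine sumZeroExtend_injective F ι (Subtype.ext ?_)
    rw [map_zero]
    exact hc.symm
  · intro q
    obtain ⟨v, rfl⟩ := Submodule.mkQ_surjective _ q
    have hsum : ∑ a, (v.1 (ι a) - v.1 b₀) = ∑ b, (v.1 b - v.1 b₀) := by
      refine Fintype.sum_of_injective ι ι.injective _ _ (fun b hb => ?_) fun a => rfl
      rw [(hb₀ b).1 hb, sub_self]
    have hw : (fun a => v.1 (ι a) - v.1 b₀) ∈ sumZero F A := by
      rw [mem_sumZero, hsum, Finset.sum_sub_distrib, (mem_sumZero F B _).1 v.2, Finset.sum_const,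
        Finset.card_univ, nsmul_eq_mul, hB, zero_mul, sub_zero]
    refine ⟨⟨_, hw⟩, ?_⟩
    rw [LinearMap.comp_apply, Submodule.mkQ_apply, Submodule.mkQ_apply, Submodule.Quotient.eq]
    refine Submodule.mem_comap.2 (Submodule.mem_span_singleton.2 ⟨-v.1 b₀, funext fun b => ?_⟩)
    change -v.1 b₀ * 1 = (sumZeroExtend F ι _).1 b - v.1 b
    by_cases hb : b ∈ Set.range ι
    · obtain ⟨a, rfl⟩ := hb
      rw [sumZeroExtend_apply]
      ring
    · rw [sumZeroExtend_apply_of_notMem F ι _ b hb, (hb₀ b).1 hb]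
      ring

end ExtendByZero

section Reduction

variable {B : Type*}

/-- The permutations of `ℤ/11` that extend, by the identity outside `ι (ℤ/11)`, to elements
of `G`. -/
def Subgroup.extendComap (G : Subgroup (Perm B)) (ι : ZMod 11 ↪ B) : Subgroup (Perm (ZMod 11)) where
  carrier := {s | ∃ t ∈ G, (∀ a, t (ι a) = ι (s a)) ∧ ∀ b ∉ Set.range ι, t b = b}
  one_mem' := ⟨1, G.one_mem, fun _ => rfl, fun _ _ => rfl⟩
  mul_mem' := by
    rintro s s' ⟨t, ht, h1, h2⟩ ⟨t', ht', h1', h2'⟩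
    refine ⟨t * t', G.mul_mem ht ht', fun a => ?_, fun b hb => ?_⟩
    · rw [Perm.mul_apply, h1', h1, Perm.mul_apply]
    · rw [Perm.mul_apply, h2' b hb, h2 b hb]
  inv_mem' := by
    rintro s ⟨t, ht, h1, h2⟩
    refine ⟨t⁻¹, G.inv_mem ht, fun a => ?_, fun b hb => ?_⟩
    · rw [Perm.inv_eq_iff_eq, h1]
      exact congrArg ι (s.apply_symm_apply a).symm
    · rw [Perm.inv_eq_iff_eq, h2 b hb]

theorem Subgroup.card_le_card_extendComap (G : Subgroup (Perm B)) (ι : ZMod 11 ↪ B) :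
    Nat.card {t : G // ∀ b ∉ Set.range ι, t.1 b = b} ≤ Nat.card (G.extendComap ι) := by
  have hst : ∀ t : {t : G // ∀ b ∉ Set.range ι, t.1 b = b},
      ∃ s : G.extendComap ι, ∀ a, t.1.1 (ι a) = ι (s.1 a) := by
    rintro ⟨⟨t, ht⟩, hfix⟩
    have hr : ∀ a, ∃ a', ι a' = t (ι a) := by
      intro a
      by_contra h
      have h1 : t (ι a) ∉ Set.range ι := h
      have h2 : t (t (ι a)) = t (ι a) := hfix _ h1
      exact h1 ⟨a, (t.injective h2).symm⟩
    choose s hs using hr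
    have hinj : Function.Injective s := fun a a' h =>
      ι.injective (t.injective (by rw [← hs, ← hs, h]))
    exact ⟨⟨Equiv.ofBijective s (Finite.injective_iff_bijective.1 hinj), t, ht,
      fun a => (hs a).symm, hfix⟩, fun a => (hs a).symm⟩
  choose f hf using hst
  refine Nat.card_le_card_of_injective f fun t t' h => ?_
  refine Subtype.ext (Subtype.ext (Equiv.ext fun b => ?_))
  by_cases hb : b ∈ Set.range ι
  · obtain ⟨a, rfl⟩ := hb
    rw [hf, hf, h]
  · rw [t.2 b hb, t'.2 b hb]

/-- An element of order 11 acts on at most 12 points as a shift of `ℤ/11`. -/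
theorem exists_embedding_of_orderOf_eq_eleven (g : Perm B) (hg : orderOf g = 11) :
    ∃ ι : ZMod 11 ↪ B, ∀ a, g (ι a) = ι (a + 1) := by
  have h11 : g ^ 11 = 1 := by rw [← hg, pow_orderOf_eq_one]
  obtain ⟨b, hb⟩ : ∃ b, g b ≠ b := by
    by_contra! h
    have : g = 1 := Equiv.ext h
    rw [this, orderOf_one] at hg
    exact absurd hg (by norm_num)
  have hper : Function.IsPeriodicPt g 11 b := by
    change g^[11] b = b
    rw [← Perm.coe_pow, h11, Perm.one_apply]
  have hmin : Function.minimalPeriod g b = 11 := by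
    rcases (Nat.dvd_prime (by norm_num : Nat.Prime 11)).1 hper.minimalPeriod_dvd with h | h
    · exact absurd (Function.minimalPeriod_eq_one_iff_isFixedPt.1 h) hb
    · exact h
  refine ⟨⟨fun a => g^[a.val] b, fun a a' h => ?_⟩, fun a => ?_⟩
  · have := Function.iterate_injOn_Iio_minimalPeriod (f := g) (x := b)
      (by rw [hmin]; exact ZMod.val_lt a) (by rw [hmin]; exact ZMod.val_lt a') h
    exact ZMod.val_injective 11 this
  · change g (g^[a.val] b) = g^[(a + 1).val] b
    rw [← Function.iterate_succ_apply' g, ZMod.val_add,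
      ← Function.iterate_mod_minimalPeriod_eq (n := a.val.succ), hmin]
    rfl

theorem qIsVerySimple_of_card_eq_eleven [Fintype B] (G : Subgroup (Perm B)) (hB : Fintype.card B = 11)
    (hdvd : 11 ∣ Nat.card G) (hcard : 110 < Nat.card G) : QIsVerySimple G := by
  have := Fact.mk (by norm_num : Nat.Prime 11)
  obtain ⟨g, hg⟩ := exists_prime_orderOf_dvd_card' 11 hdvd
  rw [← Subgroup.orderOf_coe] at hg
  obtain ⟨ι, hι⟩ := exists_embedding_of_orderOf_eq_eleven g.1 hg
  have hsurj : Function.Surjective ι :=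
    ((Fintype.bijective_iff_injective_and_card ι).2 ⟨ι.injective, by rw [hB, ZMod.card]⟩).2
  have hrange : ∀ b, b ∈ Set.range ι := hsurj
  have hsub : IsVerySimple ((sumZeroRep (ZMod 2) (ZMod 11)).comp (G.extendComap ι).subtype) := by
    refine isVerySimple_of_shift_mem _ ⟨g, g.2, hι, fun b hb => absurd (hrange b) hb⟩ ?_
    refine lt_of_lt_of_le ?_ (G.card_le_card_extendComap ι)
    rwa [Nat.card_congr (Equiv.subtypeUnivEquiv fun t b hb => absurd (hrange b) hb)]
  have hodd : ¬ Even (Fintype.card B) := by rw [hB]; decide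
  rw [QIsVerySimple, if_neg hodd]
  refine IsVerySimple.of_linearEquiv (LinearEquiv.ofBijective (sumZeroExtend (ZMod 2) ι)
    ⟨sumZeroExtend_injective _ ι, sumZeroExtend_surjective _ ι hsurj⟩) ?_ hsub
  rintro ⟨s, t, ht, h1, h2⟩
  exact ⟨⟨t, ht⟩, sumZeroExtend_map (ZMod 2) ι s t h1 h2⟩

theorem qIsVerySimple_of_card_eq_twelve [Fintype B] (G : Subgroup (Perm B)) (hB : Fintype.card B = 12)
    (hdvd : 11 ∣ Nat.card G) (hcard : 1320 < Nat.card G) : QIsVerySimple G := by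
  classical
  have := Fact.mk (by norm_num : Nat.Prime 11)
  obtain ⟨g, hg⟩ := exists_prime_orderOf_dvd_card' 11 hdvd
  rw [← Subgroup.orderOf_coe] at hg
  obtain ⟨ι, hι⟩ := exists_embedding_of_orderOf_eq_eleven g.1 hg
  obtain ⟨b₀, hb₀⟩ : ∃ b₀, (Finset.univ.map ι)ᶜ = {b₀} := by
    rw [← Finset.card_eq_one, Finset.card_compl, Finset.card_map, Finset.card_univ, ZMod.card, hB]
  have hrange : ∀ b, b ∉ Set.range ι ↔ b = b₀ := by
    intro b
    rw [← Finset.mem_singleton, ← hb₀]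
    simp
  have hgb : g.1 b₀ = b₀ := by
    rw [← hrange]
    rintro ⟨a, ha⟩
    refine (hrange b₀).2 rfl ⟨a - 1, g.1.injective ?_⟩
    rw [hι, sub_add_cancel, ha]
  have hsub : IsVerySimple ((sumZeroRep (ZMod 2) (ZMod 11)).comp (G.extendComap ι).subtype) := by
    refine isVerySimple_of_shift_mem _ ⟨g, g.2, hι, fun b hb => ?_⟩ ?_
    · rw [(hrange b).1 hb, hgb]
    · refine lt_of_lt_of_le ?_ (G.card_le_card_extendComap ι)
      have h1 : Nat.card {t : G // ∀ b ∉ Set.range ι, t.1 b = b} =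
          Nat.card (MulAction.stabilizer G b₀) := by
        refine Nat.card_congr (Equiv.subtypeEquivRight fun t => ?_)
        simp only [hrange, forall_eq]
        rfl
      have h2 := MulAction.card_orbit_mul_card_stabilizer_eq_card_group G b₀
      simp only [← Nat.card_eq_fintype_card] at h2
      have h3 : Nat.card (MulAction.orbit G b₀) ≤ 12 := by
        rw [← hB, ← Nat.card_eq_fintype_card]
        exact Nat.card_le_card_of_injective _ Subtype.val_injective
      rw [h1]
      by_contra! h4
      have h5 := Nat.mul_le_mul h3 h4
      omega
  have heven : Even (Fintype.card B) := by rw [hB]; decide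
  rw [QIsVerySimple, if_pos heven]
  refine IsVerySimple.of_linearEquiv (LinearEquiv.ofBijective _
    (mkQ_sumZeroExtend_bijective (ZMod 2) ι b₀ hrange (by rw [hB]; rfl))) ?_ hsub
  rintro ⟨s, t, ht, h1, h2⟩
  refine ⟨⟨t, ht⟩, fun v => ?_⟩
  have h3 := sumZeroExtend_map (ZMod 2) ι s t h1 h2 v
  exact congrArg (Submodule.mkQ _) h3

end Reduction

section Orders

theorem nine_dvd_card {G : Type*} [Group G] {x y : G} (hx : x ^ 3 = 1) (hy : y ^ 3 = 1)
    (hxy : x * y = y * x) (hx1 : x ≠ 1) (hy0 : y ≠ 1) (hy1 : y ≠ x) (hy2 : y ≠ x ^ 2) :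
    9 ∣ Nat.card G := by
  have := Fact.mk Nat.prime_three
  have hmem : ∀ {u : G}, u ^ 3 = 1 → ∀ z ∈ Subgroup.zpowers u, z = 1 ∨ z = u ∨ z = u ^ 2 := by
    intro u hu z hz
    obtain ⟨k, rfl⟩ := hz
    have h1 : u ^ (3 : ℤ) = 1 := by exact_mod_cast hu
    have h2 : u ^ k = u ^ (k % 3) := by
      conv_lhs => rw [← Int.emod_add_mul_ediv k 3, zpow_add, zpow_mul, h1, one_zpow, mul_one]
    have h3 : k % 3 = 0 ∨ k % 3 = 1 ∨ k % 3 = 2 := by omega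
    simp only [h2]
    rcases h3 with h3 | h3 | h3 <;> rw [h3]
    · exact Or.inl (zpow_zero u)
    · exact Or.inr (Or.inl (zpow_one u))
    · exact Or.inr (Or.inr (zpow_ofNat u 2))
  have hyx : y ∉ Subgroup.zpowers x := fun h => by
    rcases hmem hx y h with h | h | h
    exacts [hy0 h, hy1 h, hy2 h]
  have hdisj : Disjoint (Subgroup.zpowers x) (Subgroup.zpowers y) := by
    rw [Subgroup.disjoint_def]
    intro z hz hz'
    rcases hmem hy z hz' with h | h | h
    · exact h
    · exact absurd (h ▸ hz) hyx
    · refine absurd ?_ hyx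
      have h1 : y = z ^ 2 := by
        rw [h, ← pow_mul, show 2 * 2 = 3 + 1 from rfl, pow_succ, hy, one_mul]
      rw [h1]
      exact pow_mem hz 2
  have hcomm : ∀ (m : Subgroup.zpowers x) (n : Subgroup.zpowers y),
      Commute ((Subgroup.zpowers x).subtype m) ((Subgroup.zpowers y).subtype n) := by
    rintro ⟨_, i, rfl⟩ ⟨_, j, rfl⟩
    exact Commute.zpow_zpow hxy i j
  have hinj : Function.Injective (MonoidHom.noncommCoprod _ _ hcomm) := by
    rw [MonoidHom.noncommCoprod_injective]
    refine ⟨Subtype.val_injective, Subtype.val_injective, ?_⟩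
    rwa [Subgroup.range_subtype, Subgroup.range_subtype]
  have h := Subgroup.card_dvd_of_injective _ hinj
  rwa [Nat.card_prod, Nat.card_zpowers, Nat.card_zpowers, orderOf_eq_prime hx hx1,
    orderOf_eq_prime hy hy0] at h

theorem dvd_card_of_mathieu_relations {G : Type*} [Group G] (M : Subgroup G) {a b : G}
    (ha : a ∈ M) (hb : b ∈ M) (ha11 : a ^ 11 = 1) (ha1 : a ≠ 1) (hb4 : b ^ 4 = 1) (hb2 : b ^ 2 ≠ 1)
    (hab5 : (a ^ 3 * b) ^ 5 = 1) (hab1 : a ^ 3 * b ≠ 1)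
    (hx : (a ^ 10 * b ^ 2 * a ^ 2) ^ 3 = 1) (hx1 : a ^ 10 * b ^ 2 * a ^ 2 ≠ 1)
    (hy : (b * a * b) ^ 3 = 1) (hy0 : b * a * b ≠ 1) (hy1 : b * a * b ≠ a ^ 10 * b ^ 2 * a ^ 2)
    (hy2 : b * a * b ≠ (a ^ 10 * b ^ 2 * a ^ 2) ^ 2)
    (hxy : (a ^ 10 * b ^ 2 * a ^ 2) * (b * a * b) = (b * a * b) * (a ^ 10 * b ^ 2 * a ^ 2)) :
    1980 ∣ Nat.card M := by
  have hne : ∀ {u v : M}, u.1 ≠ v.1 → u ≠ v := fun h h' => h (congrArg Subtype.val h')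
  lift a to M using ha
  lift b to M using hb
  have := Fact.mk (by norm_num : Nat.Prime 11)
  have := Fact.mk Nat.prime_five
  have := Fact.mk Nat.prime_two
  have h11 : 11 ∣ Nat.card M := by
    rw [← orderOf_eq_prime (x := a) (p := 11) (Subtype.ext ha11) (hne ha1)]
    exact orderOf_dvd_natCard _
  have h5 : 5 ∣ Nat.card M := by
    rw [← orderOf_eq_prime (x := a ^ 3 * b) (p := 5) (Subtype.ext hab5) (hne hab1)]
    exact orderOf_dvd_natCard _
  have h4 : 4 ∣ Nat.card M := by
    have : orderOf b = 2 ^ (1 + 1) :=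
      orderOf_eq_prime_pow (hne (by simpa using hb2)) (Subtype.ext (by simpa using hb4))
    rw [show 4 = orderOf b from this.symm]
    exact orderOf_dvd_natCard _
  have h9 : 9 ∣ Nat.card M := nine_dvd_card (x := a ^ 10 * b ^ 2 * a ^ 2) (y := b * a * b)
    (Subtype.ext hx) (Subtype.ext hy) (Subtype.ext hxy) (hne hx1) (hne hy0) (hne hy1) (hne hy2)
  omega

set_option maxRecDepth 100000 in
theorem dvd_card_mathieuM11 : 1980 ∣ Nat.card MathieuM11 := by
  refine dvd_card_of_mathieu_relations MathieuM11
    (a := List.formPerm [0, 1, 2, 3, 4, 5, 6, 7, 8, 9, 10])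
    (b := List.formPerm [2, 6, 10, 7] * List.formPerm [3, 9, 4, 5])
    (Subgroup.subset_closure (by simp)) (Subgroup.subset_closure (by simp))
    ?_ ?_ ?_ ?_ ?_ ?_ ?_ ?_ ?_ ?_ ?_ ?_ ?_ <;> decide

set_option maxRecDepth 100000 in
theorem dvd_card_mathieuM12 : 1980 ∣ Nat.card MathieuM12 := by
  refine dvd_card_of_mathieu_relations MathieuM12
    (a := List.formPerm [0, 1, 2, 3, 4, 5, 6, 7, 8, 9, 10])
    (b := List.formPerm [2, 6, 10, 7] * List.formPerm [3, 9, 4, 5])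
    (Subgroup.subset_closure (by simp)) (Subgroup.subset_closure (by simp))
    ?_ ?_ ?_ ?_ ?_ ?_ ?_ ?_ ?_ ?_ ?_ ?_ ?_ <;> decide

end Orders

section SpecialLinear

open Matrix

theorem Matrix.SpecialLinearGroup.prime_dvd_card_projective {R : Type*} [CommRing R]
    {p : ℕ} (hp : p.Prime) {A B : SpecialLinearGroup (Fin 2) R} (hA : A ^ p = 1)
    (hAB : B * A ≠ A * B) : p ∣ Nat.card (ProjectiveSpecialLinearGroup (Fin 2) R) := by
  have := Fact.mk hp
  have h : orderOf (A : ProjectiveSpecialLinearGroup (Fin 2) R) = p := by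
    refine orderOf_eq_prime ?_ fun h => ?_
    · rw [← QuotientGroup.mk_pow, hA, QuotientGroup.mk_one]
    · rw [QuotientGroup.eq_one_iff] at h
      exact hAB (Subgroup.mem_center_iff.1 h B)
  rw [← h]
  exact orderOf_dvd_natCard _

theorem dvd_card_projectiveSpecialLinearGroup_eleven :
    165 ∣ Nat.card (ProjectiveSpecialLinearGroup (Fin 2) (ZMod 11)) := by
  have h11 : 11 ∣ Nat.card (ProjectiveSpecialLinearGroup (Fin 2) (ZMod 11)) :=
    SpecialLinearGroup.prime_dvd_card_projective (by norm_num) (A := ⟨!![1, 1; 0, 1], by decide⟩)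
      (B := ⟨!![1, 0; 1, 1], by decide⟩) (by decide) (by decide)
  have h5 : 5 ∣ Nat.card (ProjectiveSpecialLinearGroup (Fin 2) (ZMod 11)) :=
    SpecialLinearGroup.prime_dvd_card_projective (by norm_num) (A := ⟨!![3, 0; 0, 4], by decide⟩)
      (B := ⟨!![1, 0; 1, 1], by decide⟩) (by decide) (by decide)
  have h3 : 3 ∣ Nat.card (ProjectiveSpecialLinearGroup (Fin 2) (ZMod 11)) :=
    SpecialLinearGroup.prime_dvd_card_projective (by norm_num) (A := ⟨!![0, 10; 1, 10], by decide⟩)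
      (B := ⟨!![1, 0; 1, 1], by decide⟩) (by decide) (by decide)
  omega

end SpecialLinear

theorem theorem6p10 {B : Type*} [Fintype B] (G : Subgroup (Equiv.Perm B))
    (h : (Fintype.card B = 11 ∧
            (Nonempty (G ≃* Matrix.ProjectiveSpecialLinearGroup (Fin 2) (ZMod 11)) ∨
              Nonempty (G ≃* MathieuM11))) ∨
         (Fintype.card B = 12 ∧
            (Nonempty (G ≃* MathieuM12) ∨
              (Nonempty (G ≃* MathieuM11) ∧ MulAction.IsPretransitive G B)))) :
    QIsVerySimple G := by
  have hpos : 0 < Nat.card G := Nat.card_pos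
  have hM11 : Nonempty (G ≃* MathieuM11) → 1980 ∣ Nat.card G := fun ⟨e⟩ => by
    rw [Nat.card_congr e.toEquiv]
    exact dvd_card_mathieuM11
  rcases h with ⟨hB, ⟨⟨e⟩⟩ | h⟩ | ⟨hB, ⟨⟨e⟩⟩ | ⟨h, -⟩⟩
  · have hd : 165 ∣ Nat.card G := by
      rw [Nat.card_congr e.toEquiv]
      exact dvd_card_projectiveSpecialLinearGroup_eleven
    have := Nat.le_of_dvd hpos hd
    exact qIsVerySimple_of_card_eq_eleven G hB ((by norm_num : 11 ∣ 165).trans hd) (by omega)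
  · have := Nat.le_of_dvd hpos (hM11 h)
    exact qIsVerySimple_of_card_eq_eleven G hB ((by norm_num : 11 ∣ 1980).trans (hM11 h)) (by omega)
  · have hd : 1980 ∣ Nat.card G := by
      rw [Nat.card_congr e.toEquiv]
      exact dvd_card_mathieuM12
    have := Nat.le_of_dvd hpos hd
    exact qIsVerySimple_of_card_eq_twelve G hB ((by norm_num : 11 ∣ 1980).trans hd) (by omega)
  · have := Nat.le_of_dvd hpos (hM11 h)
    exact qIsVerySimple_of_card_eq_twelve G hB ((by norm_num : 11 ∣ 1980).trans (hM11 h)) (by omega)
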